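/- **Model.** A principal and an agent interact for $T\ge 2$ rounds. The agent has a finite set $A$ of solutions. In each round $t$ the utilities $(X_a^{(t)},Y_a^{(t)})_{a\in A}\in([0,1]^2)^A$ of the principal and the agent are drawn i.i.d. across rounds from a law unknown to the principal (arbitrarily correlated within a round). The principal announces a threshold $\tau_t$, which makes the solutions with $X_a^{(t)}\ge\tau_t$ eligible. The agent, who sees the realized utilities of the rounds up to $t$ (and may randomize) but not those of later rounds, proposes a solution or nothing. An eligible proposal $a$ yields $X_a^{(t)}$ to the principal and $Y_a^{(t)}$ to the agent; otherwise both get $0$. The principal observes only the utilities she receives. Given the principal's mechanism, a $\gamma$-discounting strategic agent ($0<\gamma<1$) uses a policy that maximizes his expected discounted utility $\mathbb E\sum_{t=1}^{T}\gamma^{t-1}y_t$ over all such policies, where $y_t$ is the utility he receives in round $t$. Put $T_\gamma=1/(1-\gamma)$. Let $f(\tau)$ be the expected utility of the principal in one round with threshold $\tau$ when the agent best responds myopically (ties broken in favour of the principal). The regret of a mechanism against a policy of the agent is $T\cdot\sup_{\tau\in[0,1]}f(\tau)-\mathbb E\sum_{t=1}^{T}x_t$, where $x_t$ is the principal's utility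 in round $t$; the worst-case regret is the supremum over all optimal policies of the $\gamma$-discounting agent. **Assumptions.** (i) $Y_a>y_{\min}$ almost surely for every $a\in A$, with a known $y_{\min}>0$. (ii) Stochastic Lipschitz continuity with a known parameter $L_1>0$: almost surely $L_1|X_a-X_b|\le|Y_a-Y_b|$ for all $a,b\in A$. (iii) On $[0,1]$, $f$ is upper semicontinuous (for instance continuous) and attains its maximum at a unique point $\tau^*$; moreover $\tau^*\in(0,1)$, $f$ is twice differentiable at $\tau^*$, and $f''(\tau^*)<0$. **Algorithm.** Delayed successive elimination with arms $i=1,\dots,Q$ (arm $i$ is the threshold $i/Q$), delay $D$ and perturbation $\delta$, where $\varepsilon=\min(L_1/T,y_{\min})$, $Q=\lceil (T/\log T)^{1/4}\rceil$, $D=\lceil T_\gamma\log(T_\gamma/\varepsilon)\rceil$ and $\delta=\varepsilon/L_1$. All arms are active at first. The algorithm works in phases, each of which pulls every active arm once. When a phase ends after $t>D$ rounds, let $n_i$ be the maximum of $1$ and the number of pulls of arm $i$ in rounds $1,\dots,t-D$, let $\hat\mu_i$ be $1/n_i$ times the sum of the rewards $x_s$ of these pulls, and remove every active $i$ for which some active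 $j$ satisfies $\hat\mu_i+\sqrt{2\log T/n_i}+\delta<\hat\mu_j-\sqrt{2\log T/n_j}-\delta$. **Theorem.** Under these assumptions the worst-case regret of the algorithm is at most $$C\left(\sqrt{T\log T}+T_\gamma\log\!\left(T_\gamma\max\!\left(\frac{T}{L_1},\frac1{y_{\min}}\right)\right)\log T\right),$$ where the constant $C$ depends only on the function $f$ (not on $T,\gamma,L_1,y_{\min}$, the number of solutions, or the law of the utilities beyond $f$). -/

import Mathlib

open MeasureTheory ProbabilityTheory Set

/-- The ex-post utilities of the solutions in one round: `(w a).1` is the principal's utility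
`X_a` and `(w a).2` is the agent's utility `Y_a` of the solution `a`. -/
abbrev Realization (A : Type*) := A → ℝ × ℝ

namespace Realization

variable {A : Type*}

/-- The principal's utility of a proposal; `none` is the null solution, worth `0`. -/
def principalUtility (w : Realization A) : Option A → ℝ
  | none => 0
  | some a => (w a).1

/-- The agent's utility of a proposal; the null solution is worth `0`. -/
def agentUtility (w : Realization A) : Option A → ℝ
  | none => 0
  | some a => (w a).2

/-- A solution is eligible if its utility for the principal lies in the eligible set `E`.
The null solution is always available. -/
def Eligible (w : Realization A) (E : Set ℝ) : Option A → Prop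
  | none => True
  | some a => (w a).1 ∈ E

open Classical in
/-- The principal's payoff in a round with eligible set `E` and the given proposal: an ineligible
proposal is rejected and yields `0`. -/
noncomputable def principalPayoff (w : Realization A) (E : Set ℝ) (a : Option A) : ℝ :=
  if w.Eligible E a then w.principalUtility a else 0

open Classical in
/-- The agent's payoff in a round with eligible set `E` and the given proposal. -/
noncomputable def agentPayoff (w : Realization A) (E : Set ℝ) (a : Option A) : ℝ :=
  if w.Eligible E a then w.agentUtility a else 0

/-- The myopic best responses of the agent to the eligible set `E`. -/
def bestResponses (w : Realization A) (E : Set ℝ) : Set (Option A) :=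
  {a | w.Eligible E a ∧ ∀ b, w.Eligible E b → w.agentUtility b ≤ w.agentUtility a}

/-- The principal's utility of the myopic best response to `E`, ties of the agent being broken in
favour of the principal. -/
noncomputable def bestResponseValue (w : Realization A) (E : Set ℝ) : ℝ :=
  sSup (w.principalUtility '' w.bestResponses E)

end Realization

/-- An instance of stochastic delegated choice with set of solutions `A`: the joint law, within a
round, of the utilities of all the solutions. Utilities lie in `[0, 1]`; they may be correlated in
any way within a round. -/
structure DelegationInstance (A : Type*) where
  law : Measure (Realization A)
  isProbabilityMeasure : IsProbabilityMeasure law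
  mem_unit : ∀ᵐ w ∂law, ∀ a, (w a).1 ∈ Icc (0 : ℝ) 1 ∧ (w a).2 ∈ Icc (0 : ℝ) 1

namespace DelegationInstance

variable {A : Type*} (I : DelegationInstance A)

/-- `f(τ)`: the principal's expected utility in a round when she announces the threshold `τ`, that
is the eligible set `{a | X_a ≥ τ}`, and the agent best responds myopically. -/
noncomputable def thresholdValue (τ : ℝ) : ℝ :=
  ∫ w, w.bestResponseValue (Ici τ) ∂I.law

/-- The benchmark: `T` times the best expected utility of a fixed threshold in `[0, 1]` against a
myopic agent. -/
noncomputable def opt (T : ℕ) : ℝ :=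
  T * sSup (I.thresholdValue '' Icc 0 1)

/-- The agent's utility of every (non-null) solution is always greater than `ymin`. -/
def AgentUtilityGT (ymin : ℝ) : Prop :=
  ∀ᵐ w ∂I.law, ∀ a, ymin < (w a).2

/-- Stochastic Lipschitz continuity with parameter `L₁`: ex post,
`L₁ |X_a - X_b| ≤ |Y_a - Y_b|` for all non-null solutions `a`, `b`. -/
def StochasticLipschitz (L₁ : ℝ) : Prop :=
  ∀ᵐ w ∂I.law, ∀ a b, L₁ * |(w a).1 - (w b).1| ≤ |(w a).2 - (w b).2|

end DelegationInstance

/-- A (deterministic) repeated single-proposal mechanism: in round `t` (rounds are numbered from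
`0`) it announces an eligible set that depends on the utilities which the principal received in
the rounds before `t`. -/
abbrev Mechanism := (t : ℕ) → (Fin t → ℝ) → Set ℝ

section Play

variable {A : Type*}

/-- The utility received by the principal in round `t`, for the realizations `w` and the
proposals `a`. -/
noncomputable def reward (M : Mechanism) (w : ℕ → Realization A) (a : ℕ → Option A) (t : ℕ) : ℝ :=
  (w t).principalPayoff (M t fun s : Fin t => reward M w a s) (a t)
termination_by t
decreasing_by exact s.2

/-- The eligible set announced in round `t`. -/
noncomputable def announced (M : Mechanism) (w : ℕ → Realization A) (a : ℕ → Option A) (t : ℕ) :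
    Set ℝ :=
  M t fun s : Fin t => reward M w a s

/-- The `γ`-discounted total utility of the agent over `T` rounds. -/
noncomputable def discountedUtility (M : Mechanism) (γ : ℝ) (T : ℕ) (w : ℕ → Realization A)
    (a : ℕ → Option A) : ℝ :=
  ∑ t ∈ Finset.range T, γ ^ t * (w t).agentPayoff (announced M w a t) (a t)

end Play

/-- A realization on a probability space of the repeated game for the instance `I`. The utilities
`w 0, w 1, …` of the successive rounds are i.i.d. with law `I.law`. The σ-algebra `info t` is what
the agent knows when he makes his proposal in round `t`: it contains the realized utilities of the
rounds up to `t`, possibly with private randomization, and nothing about later rounds. -/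
structure DelegationProcess {A : Type*} (I : DelegationInstance A) {Ω : Type*}
    [mΩ : MeasurableSpace Ω] (P : Measure Ω) where
  w : ℕ → Ω → Realization A
  info : Filtration ℕ mΩ
  measurable_w : ∀ t, Measurable[info t] (w t)
  map_w : ∀ t, P.map (w t) = I.law
  indep : ∀ t, Indep (info t) (MeasurableSpace.comap (w (t + 1)) inferInstance) P

namespace DelegationProcess

variable {A : Type*} {I : DelegationInstance A} {Ω : Type*} [MeasurableSpace Ω] {P : Measure Ω}
  (R : DelegationProcess I P)

/-- A policy of the agent: the proposal of each round is determined by his information. -/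
def IsPolicy (σ : ℕ → Ω → Option A) : Prop :=
  ∀ t a, MeasurableSet[R.info t] (σ t ⁻¹' {a})

/-- The expected `γ`-discounted utility of the agent over `T` rounds. -/
noncomputable def agentValue (M : Mechanism) (γ : ℝ) (T : ℕ) (σ : ℕ → Ω → Option A) : ℝ :=
  ∫ ω, discountedUtility M γ T (fun t => R.w t ω) (fun t => σ t ω) ∂P

/-- The policies of a `γ`-discounting strategic agent, who knows the mechanism: those which
maximize the expected discounted utility among all policies. -/
def IsStrategic (M : Mechanism) (γ : ℝ) (T : ℕ) (σ : ℕ → Ω → Option A) : Prop :=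
  R.IsPolicy σ ∧ ∀ σ', R.IsPolicy σ' → R.agentValue M γ T σ' ≤ R.agentValue M γ T σ

/-- The Stackelberg regret of the mechanism over `T` rounds against the policy `σ`. -/
noncomputable def regret (M : Mechanism) (T : ℕ) (σ : ℕ → Ω → Option A) : ℝ :=
  I.opt T - ∫ ω, ∑ t ∈ Finset.range T, reward M (fun t => R.w t ω) (fun t => σ t ω) t ∂P

end DelegationProcess

namespace SuccessiveElimination

/-- The state of the algorithm after some number of rounds: the active arms, the active arms that
are still to be pulled in the current phase, and the arms pulled so far, in order. -/
structure State where
  active : Finset ℕ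
  queue : List ℕ
  pulls : List ℕ

/-- The number of pulls of arm `i` in the first `m` rounds, or `1` if there is none. -/
def count (pulls : List ℕ) (m i : ℕ) : ℕ :=
  max ((pulls.take m).count i) 1

/-- The empirical mean of the rewards `r` of arm `i` in the first `m` rounds. -/
noncomputable def mean (r : ℕ → ℝ) (pulls : List ℕ) (m i : ℕ) : ℝ :=
  (∑ s ∈ Finset.range m, if pulls[s]? = some i then r s else 0) / count pulls m i

/-- The half-width `√(2 log T / n) + δ` of the confidence interval of arm `i`. -/
noncomputable def radius (T : ℕ) (δ : ℝ) (pulls : List ℕ) (m i : ℕ) : ℝ :=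
  √(2 * Real.log T / count pulls m i) + δ

open Classical in
/-- The active arms that survive, given the rewards of the first `m` rounds: arm `i` is dropped
if its upper confidence bound is less than the lower confidence bound of some active arm. -/
noncomputable def survivors (T : ℕ) (δ : ℝ) (r : ℕ → ℝ) (pulls : List ℕ) (m : ℕ)
    (S : Finset ℕ) : Finset ℕ :=
  S.filter fun i => ∀ j ∈ S,
    mean r pulls m j - radius T δ pulls m j ≤ mean r pulls m i + radius T δ pulls m i

/-- The state after `t` rounds with rewards `r 0, …, r (t - 1)`. The arms are `1, …, Q`. Every phase
pulls each active arm once. At the end of a phase, arms are eliminated on the basis of the rewards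
that are at least `D` rounds old. -/
noncomputable def state (T Q D : ℕ) (δ : ℝ) (r : ℕ → ℝ) : ℕ → State
  | 0 => ⟨Finset.Icc 1 Q, (Finset.Icc 1 Q).sort (· ≤ ·), []⟩
  | t + 1 =>
    let st := state T Q D δ r t
    let pulls := st.pulls ++ [st.queue.headD 1]
    match st.queue.tail with
    | i :: q => ⟨st.active, i :: q, pulls⟩
    | [] =>
      let S := if D < t + 1 then survivors T δ r pulls (t + 1 - D) st.active else st.active
      ⟨S, S.sort (· ≤ ·), pulls⟩

/-- The arm pulled in round `t`, given the rewards of the rounds before `t`. -/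
noncomputable def arm (T Q D : ℕ) (δ : ℝ) (t : ℕ) (h : Fin t → ℝ) : ℕ :=
  (state T Q D δ (fun s => if hs : s < t then h ⟨s, hs⟩ else 0) t).queue.headD 1

/-- Delayed successive elimination over the thresholds `i / Q`, `i = 1, …, Q`, with delay `D` and
perturbation `δ`: pulling arm `i` means announcing the eligible set `{a | X_a ≥ i / Q}`. -/
noncomputable def mechanism (T Q D : ℕ) (δ : ℝ) : Mechanism :=
  fun t h => Ici ((arm T Q D δ t h : ℝ) / Q)

end SuccessiveElimination

/-- `T_γ = 1 / (1 - γ)`. -/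
noncomputable def effectiveHorizon (γ : ℝ) : ℝ := 1 / (1 - γ)

/-- Delayed successive elimination tuned to the known parameters: with `ε = min (L₁ / T) ymin`, it
uses `⌈(T / log T) ^ (1 / 4)⌉` thresholds, delay `⌈T_γ log (T_γ / ε)⌉` and perturbation `ε / L₁`. -/
noncomputable def delayedSuccessiveElimination (T : ℕ) (γ L₁ ymin : ℝ) : Mechanism :=
  let ε := min (L₁ / T) ymin
  SuccessiveElimination.mechanism T ⌈((T : ℝ) / Real.log T) ^ (1 / 4 : ℝ)⌉₊
    ⌈effectiveHorizon γ * Real.log (effectiveHorizon γ / ε)⌉₊ (ε / L₁)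

/-!
The proof separates the strategic from the statistical side of the problem.

*The agent is almost myopic.* The announcement of round `t + D` or earlier does not depend on the
reward of round `t`. A proposal of round `t` therefore influences the agent's later utility only
in rounds after `t + D`, whose total weight is at most `γ ^ t * ε` by the choice of `D`. If with
positive probability some eligible solution beat the proposal of round `t` by more than `ε`, then
proposing this solution, and keeping to the policy otherwise, would be a better policy
(`IsStrategic.ae_near_optimal`). As `ε ≤ ymin`, the agent never declines when some solution is
eligible, and by stochastic Lipschitz continuity his proposal gives the principal the value of
the myopic best response up to `δ = ε / L₁ ≤ 1 / T`
(`Realization.abs_principalPayoff_sub_bestResponseValue_le`).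

*The confidence intervals are valid.* The arm of a round is determined by the past, of which the
utilities of the round are independent. For each arm and each `n`, the exponential supermartingale
of the first `n` pulls (`integral_exp_selectedSum_le_one`), Chernoff's bound and a union bound show
that all the empirical means are within their confidence radius of the true means outside of
an event of probability at most `1 / T` (`measureReal_badEvent_le`).

*Elimination with delay.* When the intervals are valid, the best arm is never eliminated, and an arm
that survives a test with `n` observed pulls has gap at most `8 √(log T / n) + 4δ`. As active arms
are pulled in turn, an arm receives at most `D / k + 2` further pulls during the delay, where `k` is
the number of arms active when it is eliminated. The sum of `1 / k` over the arms is at most a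
harmonic number, so that the delay costs at most `D (1 + log Q)`
(`ConfidenceValid.exists_numPulls_le`, `ConfidenceValid.sum_gap_le`).

*The grid.* By compactness, the objective lies between two parabolas with vertex at its
maximizer (`exists_quadratic_bounds`). Hence the best arm loses `O(1 / Q ^ 2)` per round, while the
arms `i` with a larger loss have gap of order `(1 + (i - Q τs) ^ 2) / Q ^ 2`, and their exploration
costs, `log T` divided by the gap, sum to `O(Q ^ 2 log T)`. With `Q` about `(T / log T) ^ (1 / 4)`
both contributions are `O(√(T log T))`.
-/

/-! ### Dynamics of successive elimination -/

namespace SuccessiveElimination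

section Dynamics

variable {T Q D : ℕ} {δ : ℝ} {r r' : ℕ → ℝ}

theorem mean_congr {pulls : List ℕ} {m : ℕ} (h : ∀ s < m, r s = r' s) (i : ℕ) :
    mean r pulls m i = mean r' pulls m i := by
  unfold mean
  congr 1
  refine Finset.sum_congr rfl fun s hs => ?_
  rw [h s (Finset.mem_range.1 hs)]

theorem survivors_congr {pulls : List ℕ} {m : ℕ} (h : ∀ s < m, r s = r' s) (S : Finset ℕ) :
    survivors T δ r pulls m S = survivors T δ r' pulls m S := by
  unfold survivors
  simp only [mean_congr h]

theorem state_succ_of_tail_eq_cons {t i : ℕ} {q : List ℕ}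
    (h : (state T Q D δ r t).queue.tail = i :: q) :
    state T Q D δ r (t + 1) = ⟨(state T Q D δ r t).active, i :: q,
      (state T Q D δ r t).pulls ++ [(state T Q D δ r t).queue.headD 1]⟩ := by
  rw [state]
  simp only [h]

theorem state_succ_of_tail_eq_nil {t : ℕ} (h : (state T Q D δ r t).queue.tail = []) :
    state T Q D δ r (t + 1) =
      let pulls := (state T Q D δ r t).pulls ++ [(state T Q D δ r t).queue.headD 1]
      let S := if D < t + 1 then survivors T δ r pulls (t + 1 - D) (state T Q D δ r t).active
        else (state T Q D δ r t).active
      ⟨S, S.sort (· ≤ ·), pulls⟩ := by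
  rw [state]
  simp only [h]

/-- The delay: the state after `t` rounds depends only on the rewards that are at least `D + 1`
rounds older than round `t`. -/
theorem state_congr {t : ℕ} (h : ∀ s, s + D < t → r s = r' s) :
    state T Q D δ r t = state T Q D δ r' t := by
  induction t with
  | zero => rfl
  | succ t ih =>
    have ih := ih fun s hs => h s (by omega)
    rcases hq : (state T Q D δ r t).queue.tail with _ | ⟨i, q⟩
    · rw [state_succ_of_tail_eq_nil hq, state_succ_of_tail_eq_nil (ih ▸ hq), ih]
      dsimp only
      split_ifs with hD
      · rw [survivors_congr fun s hs => h s (by omega)]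
      · rfl
    · rw [state_succ_of_tail_eq_cons hq, state_succ_of_tail_eq_cons (ih ▸ hq), ih]

variable (T Q D δ r) in
/-- The arm pulled in round `t` when the rewards are `r`. -/
noncomputable def armAt (t : ℕ) : ℕ := (state T Q D δ r t).queue.headD 1

theorem armAt_congr {t : ℕ} (h : ∀ s, s + D < t → r s = r' s) :
    armAt T Q D δ r t = armAt T Q D δ r' t := by
  rw [armAt, armAt, state_congr h]

theorem arm_eq_armAt (t : ℕ) : arm T Q D δ t (fun s : Fin t => r s) = armAt T Q D δ r t := by
  refine armAt_congr fun s hs => ?_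
  rw [dif_pos (by omega)]

theorem pulls_succ (t : ℕ) : (state T Q D δ r (t + 1)).pulls =
    (state T Q D δ r t).pulls ++ [armAt T Q D δ r t] := by
  rcases hq : (state T Q D δ r t).queue.tail with _ | ⟨i, q⟩
  · rw [state_succ_of_tail_eq_nil hq]; rfl
  · rw [state_succ_of_tail_eq_cons hq]; rfl

theorem pulls_eq (t : ℕ) :
    (state T Q D δ r t).pulls = (List.range t).map (armAt T Q D δ r) := by
  induction t with
  | zero => rfl
  | succ t ih => rw [pulls_succ, ih, List.range_succ, List.map_append]; rfl

theorem active_succ_subset (t : ℕ) :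
    (state T Q D δ r (t + 1)).active ⊆ (state T Q D δ r t).active := by
  rcases hq : (state T Q D δ r t).queue.tail with _ | ⟨i, q⟩
  · rw [state_succ_of_tail_eq_nil hq]
    dsimp only
    split_ifs
    · exact Finset.filter_subset _ _
    · exact subset_rfl
  · rw [state_succ_of_tail_eq_cons hq]

theorem active_antitone : Antitone fun t => (state T Q D δ r t).active :=
  antitone_nat_of_succ_le active_succ_subset

theorem survivors_nonempty (hδ : 0 ≤ δ) {pulls : List ℕ} {m : ℕ} {S : Finset ℕ}
    (hS : S.Nonempty) : (survivors T δ r pulls m S).Nonempty := by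
  classical
  obtain ⟨i, hi, hmax⟩ := S.exists_max_image (fun j => mean r pulls m j - radius T δ pulls m j) hS
  refine ⟨i, Finset.mem_filter.2 ⟨hi, fun j hj => (hmax j hj).trans ?_⟩⟩
  have := Real.sqrt_nonneg (2 * Real.log T / count pulls m i)
  simp only [radius]
  linarith

end Dynamics

/-! ### Counting pulls -/

/-- The number of rounds before round `m` in which the sequence `a` of arms pulls arm `i`. -/
def numPulls (a : ℕ → ℕ) (m i : ℕ) : ℕ := ∑ s ∈ Finset.range m, if a s = i then 1 else 0

theorem numPulls_succ (a : ℕ → ℕ) (m i : ℕ) :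
    numPulls a (m + 1) i = numPulls a m i + if a m = i then 1 else 0 := by
  rw [numPulls, Finset.sum_range_succ]; rfl

theorem numPulls_mono (a : ℕ → ℕ) (i : ℕ) : Monotone fun m => numPulls a m i :=
  monotone_nat_of_le_succ fun m => by rw [numPulls_succ]; omega

theorem numPulls_le (a : ℕ → ℕ) (m i : ℕ) : numPulls a m i ≤ m := by
  induction m with
  | zero => simp [numPulls]
  | succ m ih => rw [numPulls_succ]; split_ifs <;> omega

theorem count_map_range (a : ℕ → ℕ) (m i : ℕ) :
    ((List.range m).map a).count i = numPulls a m i := by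
  induction m with
  | zero => simp [numPulls]
  | succ m ih =>
    rw [List.range_succ, List.map_append, List.count_append, ih, numPulls_succ]
    simp [List.count_cons]

theorem count_eq (a : ℕ → ℕ) {t m : ℕ} (h : m ≤ t) (i : ℕ) :
    count ((List.range t).map a) m i = max (numPulls a m i) 1 := by
  rw [count, ← List.map_take, List.take_range, min_eq_left h, count_map_range]

theorem mean_eq (r : ℕ → ℝ) (a : ℕ → ℕ) {t m : ℕ} (h : m ≤ t) (i : ℕ) :
    mean r ((List.range t).map a) m i =
      (∑ s ∈ Finset.range m, if a s = i then r s else 0) / (max (numPulls a m i) 1 : ℕ) := by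
  rw [mean, count_eq a h]
  congr 1
  refine Finset.sum_congr rfl fun s hs => ?_
  have : s < t := (Finset.mem_range.1 hs).trans_le h
  simp [this]

theorem radius_eq (T : ℕ) (δ : ℝ) (a : ℕ → ℕ) {t m : ℕ} (h : m ≤ t) (i : ℕ) :
    radius T δ ((List.range t).map a) m i =
      √(2 * Real.log T / (max (numPulls a m i) 1 : ℕ)) + δ := by
  rw [radius, count_eq a h]

theorem sum_numPulls_le (a : ℕ → ℕ) (m : ℕ) (S : Finset ℕ) : ∑ i ∈ S, numPulls a m i ≤ m := by
  unfold numPulls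
  rw [Finset.sum_comm]
  calc _ ≤ ∑ s ∈ Finset.range m, 1 := Finset.sum_le_sum fun s _ => by
        rw [Finset.sum_ite_eq]; split_ifs <;> simp
    _ = m := by simp

theorem sum_numPulls_sub_le (a : ℕ → ℕ) {m t : ℕ} (h : m ≤ t) (S : Finset ℕ) :
    ∑ i ∈ S, (numPulls a t i - numPulls a m i : ℝ) ≤ t - m := by
  induction t, h using Nat.le_induction with
  | base => simp
  | succ t h ih =>
    have : ∀ i, (numPulls a (t + 1) i - numPulls a m i : ℝ) =
        (numPulls a t i - numPulls a m i) + if a t = i then 1 else 0 := fun i => by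
      rw [numPulls_succ]; push_cast; ring
    simp only [this, Finset.sum_add_distrib, Finset.sum_ite_eq]
    push_cast
    split_ifs <;> linarith

/-! ### Phases -/

section Phases

variable {T Q D : ℕ} {δ : ℝ} {r : ℕ → ℝ}

/-- The confidence test that arm `i` passes against arm `j` on the data of the first `m` rounds:
its upper confidence bound is not below the lower confidence bound of `j`. -/
def PassesTest (T : ℕ) (δ : ℝ) (r : ℕ → ℝ) (a : ℕ → ℕ) (m i j : ℕ) : Prop :=
  (∑ s ∈ Finset.range m, if a s = j then r s else 0) / (max (numPulls a m j) 1 : ℕ) -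
      (√(2 * Real.log T / (max (numPulls a m j) 1 : ℕ)) + δ) ≤
    (∑ s ∈ Finset.range m, if a s = i then r s else 0) / (max (numPulls a m i) 1 : ℕ) +
      (√(2 * Real.log T / (max (numPulls a m i) 1 : ℕ)) + δ)

theorem mem_survivors {a : ℕ → ℕ} {t m i : ℕ} (h : m ≤ t) {S : Finset ℕ} :
    i ∈ survivors T δ r ((List.range t).map a) m S ↔
      i ∈ S ∧ ∀ j ∈ S, PassesTest T δ r a m i j := by
  classical
  simp only [survivors, Finset.mem_filter, mean_eq r a h, radius_eq T δ a h, PassesTest]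

/-- The structure of the current phase, which began after `u` rounds: the pulls since then,
followed by the queue, enumerate the active arms; when the phase began, the active arms had all been
pulled equally often, and those elimination tests had been passed that the delay permits. -/
theorem exists_phase_start (hδ : 0 ≤ δ) (hQ : 1 ≤ Q) (t : ℕ) :
    ∃ u ≤ t, ∃ l : List ℕ,
      (state T Q D δ r t).pulls = (state T Q D δ r u).pulls ++ l ∧
      l ++ (state T Q D δ r t).queue = (state T Q D δ r t).active.sort (· ≤ ·) ∧
      (state T Q D δ r t).queue ≠ [] ∧
      (∀ i ∈ (state T Q D δ r t).active, ∀ j ∈ (state T Q D δ r t).active,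
        numPulls (armAt T Q D δ r) u i = numPulls (armAt T Q D δ r) u j) ∧
      (D < u → ∀ i ∈ (state T Q D δ r t).active, ∀ j ∈ (state T Q D δ r t).active,
        PassesTest T δ r (armAt T Q D δ r) (u - D) i j) := by
  have ne : ∀ S : Finset ℕ, S.Nonempty → S.sort (· ≤ ·) ≠ [] := fun S hS h => by
    have := Finset.length_sort (s := S) (r := (· ≤ ·))
    rw [h] at this
    exact hS.card_ne_zero this.symm
  induction t with
  | zero =>
    refine ⟨0, le_rfl, [], rfl, rfl, ne (Finset.Icc 1 Q) ⟨1, by simp [hQ]⟩, ?_,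
      fun h => absurd h (by omega)⟩
    intros; simp [numPulls]
  | succ t ih =>
    obtain ⟨u, hu, l, hp, hl, hne, hc, htest⟩ := ih
    obtain ⟨x, q, hxq⟩ := List.exists_cons_of_ne_nil hne
    have hx : armAt T Q D δ r t = x := by rw [armAt, hxq]; rfl
    rcases q with _ | ⟨i, q⟩
    · have hq : (state T Q D δ r t).queue.tail = [] := by rw [hxq]; rfl
      rw [hxq] at hl
      have hact : (state T Q D δ r t).active.Nonempty := by
        refine ⟨x, (Finset.mem_sort (· ≤ ·)).1 ?_⟩
        rw [← hl]; simp
      have hcount : ∀ i ∈ (state T Q D δ r t).active, numPulls (armAt T Q D δ r) (t + 1) i =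
          numPulls (armAt T Q D δ r) u i + 1 := fun i hi => by
        rw [← count_map_range, ← pulls_eq, pulls_succ, hp, hx, List.append_assoc, hl,
          List.count_append, pulls_eq, count_map_range,
          List.count_eq_one_of_mem (Finset.sort_nodup _ _) ((Finset.mem_sort _).2 hi)]
      have hsub := active_succ_subset (T := T) (Q := Q) (D := D) (δ := δ) (r := r) t
      refine ⟨t + 1, le_rfl, [], (List.append_nil _).symm, ?_, ?_, ?_, ?_⟩
      · rw [state_succ_of_tail_eq_nil hq]; rfl
      · rw [state_succ_of_tail_eq_nil hq]
        refine ne _ ?_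
        split_ifs
        · exact survivors_nonempty hδ hact
        · exact hact
      · intro i hi j hj
        rw [hcount i (hsub hi), hcount j (hsub hj), hc i (hsub hi) j (hsub hj)]
      · intro hD i hi j hj
        rw [state_succ_of_tail_eq_nil hq] at hi
        dsimp only at hi
        rw [if_pos hD, show (state T Q D δ r t).queue.headD 1 = armAt T Q D δ r t from rfl,
          ← pulls_succ, pulls_eq, mem_survivors (by omega)] at hi
        exact hi.2 j (hsub hj)
    · have hq : (state T Q D δ r t).queue.tail = i :: q := by rw [hxq]; rfl
      refine ⟨u, by omega, l ++ [x], ?_, ?_, ?_, ?_, ?_⟩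
      · rw [pulls_succ, hp, hx, List.append_assoc]
      · rw [state_succ_of_tail_eq_cons hq]
        dsimp only
        rw [← hl, hxq, List.append_assoc]; rfl
      · rw [state_succ_of_tail_eq_cons hq]; exact List.cons_ne_nil _ _
      · rw [state_succ_of_tail_eq_cons hq]; exact hc
      · rw [state_succ_of_tail_eq_cons hq]; exact htest

theorem armAt_mem_active (hδ : 0 ≤ δ) (hQ : 1 ≤ Q) (t : ℕ) :
    armAt T Q D δ r t ∈ (state T Q D δ r t).active := by
  obtain ⟨u, hu, l, hp, hl, hne, hc, htest⟩ := exists_phase_start (T := T) (D := D) (r := r) hδ hQ t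
  obtain ⟨x, q, hxq⟩ := List.exists_cons_of_ne_nil hne
  rw [armAt, ← Finset.mem_sort (· ≤ ·), ← hl, hxq]
  simp

theorem active_subset (t : ℕ) : (state T Q D δ r t).active ⊆ Finset.Icc 1 Q :=
  active_antitone (Nat.zero_le t)

theorem armAt_mem_Icc (hδ : 0 ≤ δ) (hQ : 1 ≤ Q) (t : ℕ) :
    armAt T Q D δ r t ∈ Finset.Icc 1 Q :=
  active_subset t (armAt_mem_active hδ hQ t)

/-- An active arm is pulled at most once in the current phase, which began after `u` rounds. -/
theorem exists_phase_start_numPulls (hδ : 0 ≤ δ) (hQ : 1 ≤ Q) (t : ℕ) :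
    ∃ u ≤ t, (∀ i, numPulls (armAt T Q D δ r) t i ≤ numPulls (armAt T Q D δ r) u i + 1) ∧
      (∀ i ∈ (state T Q D δ r t).active, ∀ j ∈ (state T Q D δ r t).active,
        numPulls (armAt T Q D δ r) u i = numPulls (armAt T Q D δ r) u j) ∧
      (D < u → ∀ i ∈ (state T Q D δ r t).active, ∀ j ∈ (state T Q D δ r t).active,
        PassesTest T δ r (armAt T Q D δ r) (u - D) i j) := by
  obtain ⟨u, hu, l, hp, hl, hne, hc, htest⟩ := exists_phase_start (T := T) (D := D) (r := r) hδ hQ t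
  refine ⟨u, hu, fun i => ?_, hc, htest⟩
  have hnd : l.Nodup := List.Nodup.of_append_left (hl ▸ Finset.sort_nodup _ _)
  rw [← count_map_range, ← pulls_eq, hp, List.count_append, pulls_eq, count_map_range]
  have := List.nodup_iff_count_le_one.1 hnd i
  omega

/-- Arms that are still active after `t` rounds have been pulled almost equally often at any
earlier time. -/
theorem numPulls_le_numPulls_add_one (hδ : 0 ≤ δ) (hQ : 1 ≤ Q) {m t : ℕ} (h : m ≤ t) {i j : ℕ}
    (hi : i ∈ (state T Q D δ r t).active) (hj : j ∈ (state T Q D δ r t).active) :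
    numPulls (armAt T Q D δ r) m i ≤ numPulls (armAt T Q D δ r) m j + 1 := by
  obtain ⟨u, hu, h1, hc, -⟩ :=
    exists_phase_start_numPulls (T := T) (D := D) (r := r) hδ hQ m
  have h2 := hc i (active_antitone h hi) j (active_antitone h hj)
  have h3 := numPulls_mono (armAt T Q D δ r) j hu
  have h4 := h1 i
  dsimp only at h3
  omega

/-- In the rounds from `m` to `u`, during which all the arms of a set `S` are active, each of them
takes at most its share of the pulls, up to two. -/
theorem numPulls_window (hδ : 0 ≤ δ) (hQ : 1 ≤ Q) {m u : ℕ} (h : m ≤ u) {i : ℕ}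
    (hi : i ∈ (state T Q D δ r u).active) {S : Finset ℕ} (hS : S ⊆ (state T Q D δ r u).active)
    (hne : S.Nonempty) :
    (numPulls (armAt T Q D δ r) u i : ℝ) ≤
      numPulls (armAt T Q D δ r) m i + (u - m : ℝ) / S.card + 2 := by
  have hk : (0 : ℝ) < S.card := by exact_mod_cast hne.card_pos
  have h1 := sum_numPulls_sub_le (armAt T Q D δ r) h S
  have h2 : ∑ j ∈ S, (numPulls (armAt T Q D δ r) u i - numPulls (armAt T Q D δ r) m i - 2 : ℝ) ≤
      ∑ j ∈ S, (numPulls (armAt T Q D δ r) u j - numPulls (armAt T Q D δ r) m j : ℝ) := by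
    refine Finset.sum_le_sum fun j hj => ?_
    have h3 := numPulls_le_numPulls_add_one (T := T) (D := D) (r := r) hδ hQ le_rfl hi (hS hj)
    have h4 := numPulls_le_numPulls_add_one (T := T) (D := D) (r := r) hδ hQ h (hS hj) hi
    have h3 : (numPulls (armAt T Q D δ r) u i : ℝ) ≤ numPulls (armAt T Q D δ r) u j + 1 := by
      exact_mod_cast h3
    have h4 : (numPulls (armAt T Q D δ r) m j : ℝ) ≤ numPulls (armAt T Q D δ r) m i + 1 := by
      exact_mod_cast h4
    linarith
  rw [Finset.sum_const, nsmul_eq_mul] at h2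
  have h5 := (le_div_iff₀' hk).2 (h2.trans h1)
  linarith

end Phases

end SuccessiveElimination

namespace SuccessiveElimination

/-! ### Regret of the elimination procedure when the confidence intervals are valid -/

section GoodEvent

variable {T Q D : ℕ} {δ : ℝ} {r : ℕ → ℝ} {μ : ℕ → ℝ}

/-- The empirical means of all the arms stay within the confidence radius of the true means `μ`
throughout the `T` rounds. -/
def ConfidenceValid (T Q D : ℕ) (δ : ℝ) (r μ : ℕ → ℝ) : Prop :=
  ∀ i ∈ Finset.Icc 1 Q, ∀ m ≤ T,
    |(∑ s ∈ Finset.range m, if armAt T Q D δ r s = i then r s else 0) /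
        (max (numPulls (armAt T Q D δ r) m i) 1 : ℕ) - μ i| ≤
      √(2 * Real.log T / (max (numPulls (armAt T Q D δ r) m i) 1 : ℕ)) + δ

/-- A best arm is never eliminated. -/
theorem ConfidenceValid.best_mem_active (h : ConfidenceValid T Q D δ r μ) {b : ℕ}
    (hb : b ∈ Finset.Icc 1 Q) (hbest : ∀ i ∈ Finset.Icc 1 Q, μ i ≤ μ b) {t : ℕ} (ht : t ≤ T) :
    b ∈ (state T Q D δ r t).active := by
  induction t with
  | zero => exact hb
  | succ t ih =>
    have ih := ih (by omega)
    rcases hq : (state T Q D δ r t).queue.tail with _ | ⟨i, q⟩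
    · rw [state_succ_of_tail_eq_nil hq]
      dsimp only
      split_ifs with hD
      · rw [show (state T Q D δ r t).queue.headD 1 = armAt T Q D δ r t from rfl,
          ← pulls_succ, pulls_eq, mem_survivors (by omega)]
        refine ⟨ih, fun j hj => ?_⟩
        have hj' := active_subset t hj
        have h1 := abs_le.1 (h j hj' (t + 1 - D) (by omega))
        have h2 := abs_le.1 (h b hb (t + 1 - D) (by omega))
        have h3 := hbest j hj'
        unfold PassesTest
        linarith [h1.2, h2.1]
      · exact ih
    · rw [state_succ_of_tail_eq_cons hq]; exact ih

/-- An arm that passes the test against the best arm has a gap of the order of its confidence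
radius, since both have been pulled about equally often. -/
theorem ConfidenceValid.gap_le (h : ConfidenceValid T Q D δ r μ) (hδ : 0 ≤ δ) (hQ : 1 ≤ Q)
    {b i : ℕ} (hb : b ∈ Finset.Icc 1 Q) {m t : ℕ} (hm : m ≤ T) (hmt : m ≤ t)
    (hbt : b ∈ (state T Q D δ r t).active) (hit : i ∈ (state T Q D δ r t).active)
    (htest : PassesTest T δ r (armAt T Q D δ r) m i b) :
    μ b - μ i ≤
      8 * √(Real.log T / (max (numPulls (armAt T Q D δ r) m i) 1 : ℕ)) + 4 * δ := by
  have hi := active_subset t hit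
  have h1 := abs_le.1 (h i hi m hm)
  have h2 := abs_le.1 (h b hb m hm)
  have hc := numPulls_le_numPulls_add_one hδ hQ hmt hit hbt
  unfold PassesTest at htest
  set n := max (numPulls (armAt T Q D δ r) m i) 1 with hn
  set k := max (numPulls (armAt T Q D δ r) m b) 1 with hk
  -- The arms have been pulled equally often up to one pull, and both counts are at least `1`.
  have hnk : n ≤ 2 * k := by omega
  have hn1 : (0 : ℝ) < n := by exact_mod_cast (by omega : 0 < n)
  have hk1 : (0 : ℝ) < k := by exact_mod_cast (by omega : 0 < k)
  have hnk' : (n : ℝ) ≤ 2 * k := by exact_mod_cast hnk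
  have hL : 0 ≤ Real.log T := Real.log_natCast_nonneg T
  have key : ∀ x : ℝ, x ≤ 4 * (Real.log T / n) → √x ≤ 2 * √(Real.log T / n) := fun x hx => by
    have : √(4 * (Real.log T / n)) = 2 * √(Real.log T / n) := by
      rw [Real.sqrt_mul (by norm_num), show (4 : ℝ) = 2 ^ 2 by norm_num,
        Real.sqrt_sq (by norm_num)]
    exact (Real.sqrt_le_sqrt hx).trans this.le
  have k1 := key (2 * Real.log T / n) (by
    rw [mul_div_assoc]
    have : 0 ≤ Real.log T / n := by positivity
    linarith)
  have k2 := key (2 * Real.log T / k) (by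
    rw [div_le_iff₀ hk1, mul_div_assoc', div_mul_eq_mul_div, le_div_iff₀ hn1]
    nlinarith)
  linarith [h1.1, h1.2, h2.1, h2.2]

theorem numPulls_eq_of_notMem_active (hδ : 0 ≤ δ) (hQ : 1 ≤ Q) {i m t : ℕ} (h : m ≤ t)
    (hi : i ∉ (state T Q D δ r m).active) :
    numPulls (armAt T Q D δ r) t i = numPulls (armAt T Q D δ r) m i := by
  induction t, h using Nat.le_induction with
  | base => rfl
  | succ t h ih =>
    rw [numPulls_succ, ih, if_neg]
    · rfl
    · rintro rfl
      exact hi (active_antitone h (armAt_mem_active hδ hQ t))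

open Classical in
variable (T Q D δ r) in
/-- The last time, up to `T`, at which arm `i` is active. -/
noncomputable def lastActive (i : ℕ) : ℕ :=
  Nat.findGreatest (fun t => i ∈ (state T Q D δ r t).active) T

theorem mem_active_lastActive {i : ℕ} (hi : i ∈ Finset.Icc 1 Q) :
    i ∈ (state T Q D δ r (lastActive T Q D δ r i)).active := by
  classical
  exact Nat.findGreatest_spec (P := fun t => i ∈ (state T Q D δ r t).active) (Nat.zero_le T) hi

theorem lastActive_le (i : ℕ) : lastActive T Q D δ r i ≤ T := by
  classical
  exact Nat.findGreatest_le T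

theorem active_lastActive (i : ℕ) :
    (state T Q D δ r (lastActive T Q D δ r i)).active =
      (Finset.Icc 1 Q).filter fun j => lastActive T Q D δ r i ≤ lastActive T Q D δ r j := by
  classical
  ext j
  rw [Finset.mem_filter]
  refine ⟨fun hj => ⟨active_subset _ hj, ?_⟩, fun hj => ?_⟩
  · exact Nat.le_findGreatest (lastActive_le i) hj
  · exact active_antitone hj.2 (mem_active_lastActive hj.1)

/-- The number of pulls of an arm is at most a number `n` that is compatible with its gap, plus its
share of the pulls made during the delay `D` among the arms active when it is eliminated. -/
theorem ConfidenceValid.exists_numPulls_le (h : ConfidenceValid T Q D δ r μ) (hδ : 0 ≤ δ)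
    (hQ : 1 ≤ Q) (hT : 2 ≤ T) (hμ : ∀ i ∈ Finset.Icc 1 Q, μ i ∈ Icc (0 : ℝ) 1)
    {b : ℕ} (hb : b ∈ Finset.Icc 1 Q) (hbest : ∀ i ∈ Finset.Icc 1 Q, μ i ≤ μ b)
    {i : ℕ} (hi : i ∈ Finset.Icc 1 Q) :
    ∃ n : ℕ, 1 ≤ n ∧ μ b - μ i ≤ 8 * √(Real.log T / n) + 4 * δ ∧
      (numPulls (armAt T Q D δ r) T i : ℝ) ≤ n +
        D / ((Finset.Icc 1 Q).filter fun j =>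
          lastActive T Q D δ r i ≤ lastActive T Q D δ r j).card + 4 := by
  set t := lastActive T Q D δ r i with ht
  have htT : t ≤ T := lastActive_le i
  have hit : i ∈ (state T Q D δ r t).active := mem_active_lastActive hi
  have hbt := h.best_mem_active hb hbest htT
  obtain ⟨u, hut, hu1, -, htest⟩ :=
    exists_phase_start_numPulls (T := T) (D := D) (r := r) hδ hQ t
  have hlast : numPulls (armAt T Q D δ r) T i ≤ numPulls (armAt T Q D δ r) t i + 1 := by
    rcases htT.eq_or_lt with he | hlt
    · rw [← he]; omega
    · have hni : i ∉ (state T Q D δ r (t + 1)).active := fun hmem => by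
        classical
        have : t + 1 ≤ t := Nat.le_findGreatest (P := fun t => i ∈ (state T Q D δ r t).active)
          hlt hmem
        omega
      rw [numPulls_eq_of_notMem_active hδ hQ hlt hni, numPulls_succ]
      split_ifs <;> omega
  rw [← active_lastActive]
  refine ⟨max (numPulls (armAt T Q D δ r) (u - D) i) 1, le_max_right _ _, ?_, ?_⟩
  · by_cases hD : D < u
    · exact h.gap_le hδ hQ hb (by omega) (by omega) hbt hit (htest hD i hit b hbt)
    · -- Nothing has been observed yet: the radius exceeds the largest possible gap `1`.
      have h0 : u - D = 0 := by omega
      have hL : (1 : ℝ) / 4 ≤ Real.log T := by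
        have : Real.log 2 ≤ Real.log T := Real.log_le_log (by norm_num) (by exact_mod_cast hT)
        linarith [Real.log_two_gt_d9]
      have h1 : (1 : ℝ) / 2 ≤ √(Real.log T) := Real.le_sqrt_of_sq_le (by linarith)
      have h2 := (hμ b hb).2
      have h3 := (hμ i hi).1
      simp only [h0, numPulls, Finset.range_zero, Finset.sum_empty]
      norm_num
      linarith
  · have h1 : (numPulls (armAt T Q D δ r) T i : ℝ) ≤ numPulls (armAt T Q D δ r) u i + 2 := by
      have := hu1 i
      exact_mod_cast (by omega : numPulls (armAt T Q D δ r) T i ≤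
        numPulls (armAt T Q D δ r) u i + 2)
    have h2 := numPulls_window (T := T) (D := D) (r := r) hδ hQ (Nat.sub_le u D)
      (active_antitone hut hit) (active_antitone hut) ⟨i, hit⟩
    have h3 : (u : ℝ) - ((u - D : ℕ) : ℝ) ≤ D := by
      have : u ≤ (u - D) + D := by omega
      have : (u : ℝ) ≤ ((u - D : ℕ) : ℝ) + D := by exact_mod_cast this
      linarith
    have h4 : ((u : ℝ) - ((u - D : ℕ) : ℝ)) / (state T Q D δ r t).active.card ≤
        D / (state T Q D δ r t).active.card := by gcongr
    have h5 : (numPulls (armAt T Q D δ r) (u - D) i : ℝ) ≤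
        (max (numPulls (armAt T Q D δ r) (u - D) i) 1 : ℕ) := by
      exact_mod_cast le_max_left _ _
    linarith

/-- If the elements of a finite set leave it at the times `p`, the reciprocals of the sizes of the
set when they leave sum to at most a harmonic number. -/
theorem sum_one_div_card_filter_le_harmonic {ι : Type*} [DecidableEq ι] (p : ι → ℕ)
    (s : Finset ι) :
    ∑ i ∈ s, (1 : ℝ) / (s.filter fun j => p i ≤ p j).card ≤ (harmonic s.card : ℚ) := by
  induction hn : s.card generalizing s with
  | zero => rw [Finset.card_eq_zero.1 hn]; simp
  | succ n ih =>
    obtain ⟨i, hi, hmin⟩ := s.exists_min_image p (Finset.card_pos.1 (by omega))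
    have hc : (s.erase i).card = n := by rw [Finset.card_erase_of_mem hi, hn]; rfl
    rw [← Finset.add_sum_erase _ _ hi, harmonic_succ]
    have h1 : (s.filter fun j => p i ≤ p j) = s := Finset.filter_true_of_mem hmin
    have h2 : ∑ k ∈ s.erase i, (1 : ℝ) / (s.filter fun j => p k ≤ p j).card ≤
        ∑ k ∈ s.erase i, (1 : ℝ) / ((s.erase i).filter fun j => p k ≤ p j).card := by
      refine Finset.sum_le_sum fun k hk => ?_
      have : 0 < ((s.erase i).filter fun j => p k ≤ p j).card :=
        Finset.card_pos.2 ⟨k, by simp [Finset.mem_erase.1 hk]⟩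
      gcongr
      exact Finset.erase_subset _ _
    rw [h1, hn]
    push_cast
    have := ih _ hc
    have h3 : (1 : ℝ) / ((n : ℝ) + 1) = ((n : ℝ) + 1)⁻¹ := one_div _
    linarith

/-- The regret with respect to the best arm. Arms with gap at most `θ + 8δ` contribute at most that
much per round; the other arms are covered by the weights `w`. -/
theorem ConfidenceValid.sum_gap_le (h : ConfidenceValid T Q D δ r μ) (hδ : 0 ≤ δ)
    (hQ : 1 ≤ Q) (hT : 2 ≤ T) (hμ : ∀ i ∈ Finset.Icc 1 Q, μ i ∈ Icc (0 : ℝ) 1)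
    {b : ℕ} (hb : b ∈ Finset.Icc 1 Q) (hbest : ∀ i ∈ Finset.Icc 1 Q, μ i ≤ μ b)
    {θ : ℝ} (hθ : 0 ≤ θ) {w : ℕ → ℝ} (hw0 : ∀ i ∈ Finset.Icc 1 Q, 0 ≤ w i)
    (hw : ∀ i ∈ Finset.Icc 1 Q, θ < μ b - μ i → 1 / (μ b - μ i) ≤ w i) :
    ∑ t ∈ Finset.range T, (μ b - μ (armAt T Q D δ r t)) ≤
      T * (θ + 8 * δ) + 256 * Real.log T * ∑ i ∈ Finset.Icc 1 Q, w i +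
        D * (1 + Real.log Q) + 4 * Q := by
  have hL : 0 ≤ Real.log T := Real.log_natCast_nonneg T
  set a := armAt T Q D δ r with ha
  set k : ℕ → ℝ := fun i => ((Finset.Icc 1 Q).filter fun j =>
          lastActive T Q D δ r i ≤ lastActive T Q D δ r j).card with hk
  have hk0 : ∀ i, 0 ≤ (D : ℝ) / k i := fun i => by positivity
  have harm : ∀ i ∈ Finset.Icc 1 Q, (numPulls a T i : ℝ) * (μ b - μ i) ≤
      numPulls a T i * (θ + 8 * δ) + 256 * Real.log T * w i + D * (1 / k i) + 4 := by
    intro i hi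
    have hw0i := hw0 i hi
    rw [mul_one_div]
    by_cases hgap : μ b - μ i ≤ θ + 8 * δ
    · have h1 : (numPulls a T i : ℝ) * (μ b - μ i) ≤ numPulls a T i * (θ + 8 * δ) := by gcongr
      have := hk0 i
      have : 0 ≤ 256 * Real.log T * w i := by positivity
      linarith
    · push Not at hgap
      obtain ⟨n, hn1, hn2, hn3⟩ := h.exists_numPulls_le hδ hQ hT hμ hb hbest hi
      have hn0 : (0 : ℝ) < n := by exact_mod_cast hn1
      set x := μ b - μ i with hx
      have hx0 : 0 < x := by linarith
      have hx1 : x ≤ 1 := by linarith [(hμ b hb).2, (hμ i hi).1]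
      have hx16 : x ≤ 16 * √(Real.log T / n) := by linarith
      have hsq : x ^ 2 ≤ 256 * (Real.log T / n) := by
        calc x ^ 2 ≤ (16 * √(Real.log T / n)) ^ 2 := by gcongr
          _ = 256 * (Real.log T / n) := by
            rw [mul_pow, Real.sq_sqrt (by positivity)]; norm_num
      have hnx : n * x ≤ 256 * Real.log T * (1 / x) := by
        rw [mul_one_div, le_div_iff₀ hx0]
        rw [mul_div_assoc', le_div_iff₀ hn0] at hsq
        linarith
      have hwi : 256 * Real.log T * (1 / x) ≤ 256 * Real.log T * w i := by
        gcongr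
        exact hw i hi (by linarith)
      have hDk : (D / k i + 4) * x ≤ (D / k i + 4) * 1 := by
        have := hk0 i
        gcongr
      have h0 : 0 ≤ (numPulls a T i : ℝ) * (θ + 8 * δ) := by positivity
      calc (numPulls a T i : ℝ) * x ≤ (n + D / k i + 4) * x := by gcongr
        _ = n * x + (D / k i + 4) * x := by ring
        _ ≤ _ := by linarith
  have hsum : ∑ t ∈ Finset.range T, (μ b - μ (a t)) =
      ∑ i ∈ Finset.Icc 1 Q, (numPulls a T i : ℝ) * (μ b - μ i) := by
    have : ∀ t, μ b - μ (a t) = ∑ i ∈ Finset.Icc 1 Q, (if a t = i then 1 else 0) * (μ b - μ i) :=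
      fun t => by
        simp only [ite_mul, one_mul, zero_mul, Finset.sum_ite_eq]
        rw [if_pos (armAt_mem_Icc hδ hQ t)]
    simp only [this]
    rw [Finset.sum_comm]
    refine Finset.sum_congr rfl fun i _ => ?_
    rw [← Finset.sum_mul, numPulls]
    push_cast
    rfl
  have hharm : ∑ i ∈ Finset.Icc 1 Q, 1 / k i ≤ 1 + Real.log Q := by
    have h1 := sum_one_div_card_filter_le_harmonic (lastActive T Q D δ r) (Finset.Icc 1 Q)
    rw [Nat.card_Icc, Nat.add_sub_cancel] at h1
    exact h1.trans (harmonic_le_one_add_log Q)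
  have hN : (∑ i ∈ Finset.Icc 1 Q, (numPulls a T i : ℝ)) ≤ T := by
    exact_mod_cast sum_numPulls_le a T (Finset.Icc 1 Q)
  calc _ = _ := hsum
    _ ≤ ∑ i ∈ Finset.Icc 1 Q, (numPulls a T i * (θ + 8 * δ) + 256 * Real.log T * w i +
          D * (1 / k i) + 4) := Finset.sum_le_sum harm
    _ = (∑ i ∈ Finset.Icc 1 Q, (numPulls a T i : ℝ)) * (θ + 8 * δ) +
          256 * Real.log T * ∑ i ∈ Finset.Icc 1 Q, w i +
          D * ∑ i ∈ Finset.Icc 1 Q, 1 / k i + 4 * Q := by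
      simp only [Finset.sum_add_distrib, Finset.sum_mul, Finset.mul_sum, Finset.sum_const,
        Nat.card_Icc, Nat.add_sub_cancel, nsmul_eq_mul]
      ring
    _ ≤ _ := by gcongr

end GoodEvent

end SuccessiveElimination

/-! ### The objective near its maximizer -/

/-- A function that increases towards `x₀` from both sides is maximal at `x₀`. -/
theorem le_of_hasDerivAt_mul_sub_nonpos {h h' : ℝ → ℝ} {x₀ ρ : ℝ}
    (hd : ∀ x, |x - x₀| < ρ → HasDerivAt h (h' x) x)
    (hs : ∀ x, |x - x₀| < ρ → h' x * (x - x₀) ≤ 0) {x : ℝ} (hx : |x - x₀| < ρ) :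
    h x ≤ h x₀ := by
  have hab := abs_lt.1 hx
  rcases lt_trichotomy x x₀ with hlt | rfl | hlt
  · have hball : ∀ y ∈ Icc x x₀, |y - x₀| < ρ := fun y hy =>
      abs_lt.2 ⟨by linarith [hy.1], by linarith [hy.2]⟩
    obtain ⟨c, hc, hslope⟩ := exists_hasDerivAt_eq_slope h h' hlt
      (fun y hy => (hd y (hball y hy)).continuousAt.continuousWithinAt)
      fun y hy => hd y (hball y (Ioo_subset_Icc_self hy))
    have h1 := hs c (hball c (Ioo_subset_Icc_self hc))
    have h2 : 0 ≤ h' c := by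
      by_contra! hneg
      nlinarith [hc.2]
    rw [hslope] at h2
    have := (div_nonneg_iff.1 h2).resolve_right fun h => by linarith [h.2]
    linarith [this.1]
  · exact le_rfl
  · have hball : ∀ y ∈ Icc x₀ x, |y - x₀| < ρ := fun y hy =>
      abs_lt.2 ⟨by linarith [hy.1], by linarith [hy.2]⟩
    obtain ⟨c, hc, hslope⟩ := exists_hasDerivAt_eq_slope h h' hlt
      (fun y hy => (hd y (hball y hy)).continuousAt.continuousWithinAt)
      fun y hy => hd y (hball y (Ioo_subset_Icc_self hy))
    have h1 := hs c (hball c (Ioo_subset_Icc_self hc))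
    have h2 : h' c ≤ 0 := by
      by_contra! hpos
      nlinarith [hc.1]
    rw [hslope] at h2
    rcases div_nonpos_iff.1 h2 with h3 | h3 <;> linarith [h3.1, h3.2]

/-- Near an interior maximum with negative second derivative, the loss is between two multiples of
the squared distance. -/
theorem exists_local_quadratic_bounds {f : ℝ → ℝ} {x₀ : ℝ} (hloc : IsLocalMax f x₀)
    (hdiff : ∀ᶠ x in nhds x₀, DifferentiableAt ℝ f x)
    (hdiff2 : DifferentiableAt ℝ (deriv f) x₀) (hneg : deriv (deriv f) x₀ < 0) :
    ∃ a ρ : ℝ, 0 < a ∧ 0 < ρ ∧ ∀ x, |x - x₀| < ρ →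
      a / 4 * (x - x₀) ^ 2 ≤ f x₀ - f x ∧ f x₀ - f x ≤ a * (x - x₀) ^ 2 := by
  set a := -deriv (deriv f) x₀ with ha
  have ha0 : 0 < a := by linarith
  have hO := hdiff2.hasDerivAt.isLittleO.def (half_pos ha0)
  rw [hloc.deriv_eq_zero] at hO
  obtain ⟨ρ, hρ, hball⟩ := Metric.eventually_nhds_iff.1 (hdiff.and hO)
  simp only [Real.dist_eq] at hball
  have key : ∀ x, |x - x₀| < ρ →
      -(3 * a / 2) * (x - x₀) ^ 2 ≤ deriv f x * (x - x₀) ∧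
        deriv f x * (x - x₀) ≤ -(a / 2) * (x - x₀) ^ 2 := by
    intro x hx
    have h1 := (hball hx).2
    rw [sub_zero, Real.norm_eq_abs, Real.norm_eq_abs, smul_eq_mul] at h1
    have h2 : |(deriv f x - (x - x₀) * deriv (deriv f) x₀) * (x - x₀)| ≤
        a / 2 * (x - x₀) ^ 2 := by
      rw [abs_mul, ← sq_abs (x - x₀), sq, ← mul_assoc]
      gcongr
    have h3 : deriv (deriv f) x₀ = -a := by rw [ha, neg_neg]
    rw [h3] at h2
    have h4 := abs_le.1 h2
    constructor <;> nlinarith [h4.1, h4.2]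
  have hsq : ∀ k x : ℝ, HasDerivAt (fun y => k * (y - x₀) ^ 2) (k * (2 * (x - x₀))) x := by
    intro k x
    have := (((hasDerivAt_id x).sub_const x₀).pow 2).const_mul k
    simpa using this
  refine ⟨a, ρ, ha0, hρ, fun x hx => ⟨?_, ?_⟩⟩
  · have := le_of_hasDerivAt_mul_sub_nonpos (h := fun y => f y + a / 4 * (y - x₀) ^ 2)
      (h' := fun y => deriv f y + a / 4 * (2 * (y - x₀)))
      (fun y hy => (hball hy).1.hasDerivAt.add (hsq _ y))
      (fun y hy => by nlinarith [(key y hy).2]) hx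
    simp only [sub_self] at this
    nlinarith
  · have := le_of_hasDerivAt_mul_sub_nonpos (h := fun y => -f y + -a * (y - x₀) ^ 2)
      (h' := fun y => -deriv f y + -a * (2 * (y - x₀)))
      (fun y hy => (hball hy).1.hasDerivAt.neg.add (hsq _ y))
      (fun y hy => by nlinarith [(key y hy).1, sq_nonneg (y - x₀)]) hx
    simp only [sub_self] at this
    nlinarith

/-- By compactness, the quadratic growth near a unique maximizer extends to the whole interval. -/
theorem exists_quadratic_bounds {f : ℝ → ℝ} {x₀ : ℝ} (hx₀ : x₀ ∈ Ioo (0 : ℝ) 1)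
    (hmax : ∀ x ∈ Icc (0 : ℝ) 1, x ≠ x₀ → f x < f x₀)
    (husc : UpperSemicontinuousOn f (Icc 0 1))
    (hdiff : ∀ᶠ x in nhds x₀, DifferentiableAt ℝ f x)
    (hdiff2 : DifferentiableAt ℝ (deriv f) x₀) (hneg : deriv (deriv f) x₀ < 0) :
    ∃ c C : ℝ, 0 < c ∧ 0 < C ∧ (∀ x ∈ Icc (0 : ℝ) 1, c * (x - x₀) ^ 2 ≤ f x₀ - f x) ∧
      ((∀ x ∈ Icc (0 : ℝ) 1, f x ∈ Icc (0 : ℝ) 1) →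
        ∀ x ∈ Icc (0 : ℝ) 1, f x₀ - f x ≤ C * (x - x₀) ^ 2) := by
  have hloc : IsLocalMax f x₀ := by
    filter_upwards [Icc_mem_nhds hx₀.1 hx₀.2] with x hx
    rcases eq_or_ne x x₀ with rfl | hne
    · exact le_rfl
    · exact (hmax x hx hne).le
  obtain ⟨a, ρ, ha, hρ, hq⟩ := exists_local_quadratic_bounds hloc hdiff hdiff2 hneg
  have hfar : ∃ d, 0 < d ∧ ∀ x ∈ Icc (0 : ℝ) 1, ρ ≤ |x - x₀| → d ≤ f x₀ - f x := by
    set K := Icc (0 : ℝ) 1 ∩ {x | ρ ≤ |x - x₀|} with hK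
    have hKc : IsCompact K := isCompact_Icc.inter_right
      (isClosed_le continuous_const (by fun_prop))
    rcases K.eq_empty_or_nonempty with he | hne
    · refine ⟨1, one_pos, fun x hx hxρ => absurd (show x ∈ K from ⟨hx, hxρ⟩) (by simp [he])⟩
    · obtain ⟨y, hy, hmaxy⟩ := UpperSemicontinuousOn.exists_isMaxOn hne hKc
        (husc.mono inter_subset_left)
      refine ⟨f x₀ - f y, sub_pos.2 (hmax y hy.1 ?_), fun x hx hxρ => ?_⟩
      · rintro rfl
        have := hy.2
        simp only [mem_ofPred_eq, sub_self, abs_zero] at this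
        linarith
      · have : f x ≤ f y := hmaxy (show x ∈ K from ⟨hx, hxρ⟩)
        linarith
  obtain ⟨d, hd, hfar⟩ := hfar
  have hsq1 : ∀ x ∈ Icc (0 : ℝ) 1, (x - x₀) ^ 2 ≤ 1 := fun x hx => by
    rw [sq_le_one_iff_abs_le_one, abs_le]
    constructor <;> linarith [hx.1, hx.2, hx₀.1, hx₀.2]
  refine ⟨min (a / 4) d, max a (1 / ρ ^ 2), lt_min (by positivity) hd, lt_max_of_lt_left ha,
    fun x hx => ?_, fun hf x hx => ?_⟩
  · rcases lt_or_ge |x - x₀| ρ with hlt | hge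
    · exact (mul_le_mul_of_nonneg_right (min_le_left _ _) (sq_nonneg _)).trans (hq x hlt).1
    · have := hsq1 x hx
      calc min (a / 4) d * (x - x₀) ^ 2 ≤ d * 1 :=
            mul_le_mul (min_le_right _ _) this (sq_nonneg _) hd.le
        _ ≤ _ := by rw [mul_one]; exact hfar x hx hge
  · rcases lt_or_ge |x - x₀| ρ with hlt | hge
    · exact (hq x hlt).2.trans (mul_le_mul_of_nonneg_right (le_max_left _ _) (sq_nonneg _))
    · have h1 : 1 ≤ 1 / ρ ^ 2 * (x - x₀) ^ 2 := by
        rw [one_div, inv_mul_eq_div, le_div_iff₀ (by positivity), one_mul, ← sq_abs (x - x₀)]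
        gcongr
      have h2 := mul_le_mul_of_nonneg_right (le_max_right a (1 / ρ ^ 2)) (sq_nonneg (x - x₀))
      have h3 := (hf x hx).1
      have h4 := (hf x₀ (Ioo_subset_Icc_self hx₀)).2
      linarith

/-- The inverse quadratic weights of the integer points are summable, uniformly in the centre. -/
theorem exists_sum_one_div_one_add_sq_le :
    ∃ K : ℝ, 0 < K ∧ ∀ (x : ℝ) (s : Finset ℕ), ∑ i ∈ s, 1 / (1 + ((i : ℝ) - x) ^ 2) ≤ K := by
  have hsum : Summable fun k : ℤ => 3 / (1 + (k : ℝ) ^ 2) := by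
    have h1 : Summable fun k : ℤ => 1 / (k : ℝ) ^ 2 :=
      Real.summable_one_div_int_pow.2 (by norm_num)
    have h2 : Summable fun k : ℤ => if k = 0 then (1 : ℝ) else 0 :=
      (hasSum_ite_eq (0 : ℤ) (1 : ℝ)).summable
    refine Summable.of_nonneg_of_le (fun k => by positivity) (fun k => ?_) ((h1.add h2).mul_left 3)
    rcases eq_or_ne k 0 with rfl | hk
    · simp
    · have hk2 : (0 : ℝ) < (k : ℝ) ^ 2 := by positivity
      rw [if_neg hk, add_zero, mul_one_div]
      gcongr
      linarith
  refine ⟨∑' k : ℤ, 3 / (1 + (k : ℝ) ^ 2), ?_, fun x s => ?_⟩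
  · exact hsum.tsum_pos (fun k => by positivity) 0 (by norm_num)
  · set e : ℕ ↪ ℤ := ⟨fun i => (i : ℤ) - ⌊x⌋, fun i j h => by simpa using h⟩ with he
    calc _ ≤ ∑ i ∈ s, 3 / (1 + ((e i : ℤ) : ℝ) ^ 2) := by
          refine Finset.sum_le_sum fun i _ => ?_
          have h1 := Int.floor_le x
          have h2 := Int.lt_floor_add_one x
          have h3 : ((e i : ℤ) : ℝ) = i - ⌊x⌋ := by
            change (((i : ℤ) - ⌊x⌋ : ℤ) : ℝ) = i - ⌊x⌋
            push_cast; rfl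
          rw [h3, div_le_div_iff₀ (by positivity) (by positivity)]
          -- With `k = i - ⌊x⌋` and `0 ≤ y = x - ⌊x⌋ ≤ 1`, the claim is `1 + k² ≤ 3 (1 + (k - y)²)`.
          obtain ⟨y, hy⟩ : ∃ y, y = x - ⌊x⌋ := ⟨_, rfl⟩
          have h4 : (i : ℝ) - x = (i - ⌊x⌋) - y := by rw [hy]; ring
          rw [h4]
          have hy0 : 0 ≤ y := by linarith
          have hy1 : y ≤ 1 := by linarith
          nlinarith [sq_nonneg (2 * ((i : ℝ) - ⌊x⌋) - 3 * y), mul_nonneg hy0 (sub_nonneg.2 hy1)]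
      _ = ∑ k ∈ s.map e, 3 / (1 + (k : ℝ) ^ 2) := by rw [Finset.sum_map]
      _ ≤ _ := hsum.sum_le_tsum _ fun k _ => by positivity

/-! ### Size of the grid -/

/-- The number of arms `⌈(T / log T) ^ (1 / 4)⌉` balances the discretization error `T / Q ^ 2` and
the exploration cost `Q ^ 2 * log T`. -/
theorem grid_size_bounds {T : ℕ} (hT : 2 ≤ T) {Q : ℕ}
    (hQ : Q = ⌈((T : ℝ) / Real.log T) ^ (1 / 4 : ℝ)⌉₊) :
    1 ≤ Q ∧ Q ≤ T ∧ 1 ≤ √(T * Real.log T) ∧ 1 / 2 ≤ Real.log T ∧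
      Real.log T ≤ √(T * Real.log T) ∧ (Q : ℝ) ≤ 4 * √(T * Real.log T) ∧
      T / (Q : ℝ) ^ 2 ≤ √(T * Real.log T) ∧
      Real.log T * (Q : ℝ) ^ 2 ≤ 4 * √(T * Real.log T) := by
  have hT2 : (2 : ℝ) ≤ T := by exact_mod_cast hT
  set L := Real.log T with hL
  have hL2 : 1 / 2 < L := by
    have : Real.log 2 ≤ L := Real.log_le_log (by norm_num) hT2
    linarith [Real.log_two_gt_d9]
  have hLT : L ≤ T := (Real.log_le_sub_one_of_pos (by linarith)).trans (by linarith)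
  set X := ((T : ℝ) / L) ^ (1 / 4 : ℝ) with hX
  have hdiv : 1 ≤ (T : ℝ) / L := by rw [le_div_iff₀ (by linarith)]; linarith
  have hX1 : 1 ≤ X := Real.one_le_rpow hdiv (by norm_num)
  have hX4 : X ^ 4 = T / L := by
    rw [hX, ← Real.rpow_natCast, ← Real.rpow_mul (by linarith)]
    norm_num
  have hTX : (T : ℝ) = X ^ 4 * L := by rw [hX4]; field_simp
  have hS : √(T * L) = X ^ 2 * L := by
    rw [hTX, show X ^ 4 * L * L = (X ^ 2 * L) ^ 2 by ring, Real.sqrt_sq (by positivity)]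
  have hQX : X ≤ Q := hQ ▸ Nat.le_ceil X
  have hQX2 : (Q : ℝ) ≤ 2 * X := by
    have : (Q : ℝ) < X + 1 := hQ ▸ Nat.ceil_lt_add_one (by linarith)
    linarith
  have hXX : X ≤ X ^ 2 := by nlinarith
  have hXT : X ≤ T := by
    refine le_of_pow_le_pow_left₀ (n := 4) (by norm_num) (by linarith) ?_
    rw [hX4, div_le_iff₀ (by linarith)]
    have h3 : (2 : ℝ) ^ 3 ≤ (T : ℝ) ^ 3 := by gcongr
    have : (T : ℝ) ^ 4 = T ^ 3 * T := by ring
    rw [this]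
    have h1 : 1 ≤ (T : ℝ) ^ 3 * L := by nlinarith
    nlinarith
  have hQ0 : (0 : ℝ) < Q := by linarith
  rw [hS]
  refine ⟨?_, ?_, ?_, hL2.le, ?_, ?_, ?_, ?_⟩
  · exact_mod_cast hX1.trans hQX
  · rw [hQ]; exact Nat.ceil_le.2 hXT
  · rw [← hS]
    refine Real.one_le_sqrt.2 ?_
    nlinarith
  · nlinarith
  · nlinarith
  · rw [div_le_iff₀ (by positivity), hTX]
    calc X ^ 4 * L = X ^ 2 * L * X ^ 2 := by ring
      _ ≤ _ := by gcongr
  · calc L * (Q : ℝ) ^ 2 ≤ L * (2 * X) ^ 2 := by gcongr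
      _ = _ := by ring

namespace SuccessiveElimination

/-- When the confidence intervals are valid, the regret of successive elimination on the grid of
the thresholds `i / Q`, for an objective with quadratic behaviour at its maximizer. -/
theorem ConfidenceValid.sum_regret_le {T Q D : ℕ} {δ : ℝ} {r : ℕ → ℝ} {f : ℝ → ℝ}
    (h : ConfidenceValid T Q D δ r fun i => f (i / Q)) (hδ : 0 ≤ δ) (hδT : T * δ ≤ 1)
    (hQ : 1 ≤ Q) (hT : 2 ≤ T) {τs c C K : ℝ} (hτs : τs ∈ Ioo (0 : ℝ) 1)
    (hf : ∀ x ∈ Icc (0 : ℝ) 1, f x ∈ Icc (0 : ℝ) 1) (hc : 0 < c) (hC : 0 < C)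
    (hlow : ∀ x ∈ Icc (0 : ℝ) 1, c * (x - τs) ^ 2 ≤ f τs - f x)
    (hupp : ∀ x ∈ Icc (0 : ℝ) 1, f τs - f x ≤ C * (x - τs) ^ 2)
    (hK : ∀ (x : ℝ) (s : Finset ℕ), ∑ i ∈ s, 1 / (1 + ((i : ℝ) - x) ^ 2) ≤ K) :
    ∑ t ∈ Finset.range T, (f τs - f (armAt T Q D δ r t / Q)) ≤
      2 * C * (T / (Q : ℝ) ^ 2) + 8 + 768 / min c C * K * (Real.log T * (Q : ℝ) ^ 2) +
        D * (1 + Real.log Q) + 4 * Q := by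
  have hQ0 : (0 : ℝ) < Q := by exact_mod_cast hQ
  have hgrid : ∀ i ∈ Finset.Icc 1 Q, (i : ℝ) / Q ∈ Icc (0 : ℝ) 1 := fun i hi => by
    have : (i : ℝ) ≤ Q := by exact_mod_cast (Finset.mem_Icc.1 hi).2
    exact ⟨by positivity, (div_le_one hQ0).2 this⟩
  have hμ : ∀ i ∈ Finset.Icc 1 Q, f ((i : ℝ) / Q) ∈ Icc (0 : ℝ) 1 := fun i hi => hf _ (hgrid i hi)
  obtain ⟨b, hb, hbest⟩ := (Finset.Icc 1 Q).exists_max_image (fun i => f ((i : ℝ) / Q))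
    ⟨1, by simp [hQ]⟩
  -- The grid point just above `τs` shows that the best arm loses at most `C / Q ^ 2`.
  have hη : f τs - f (b / Q) ≤ C / (Q : ℝ) ^ 2 := by
    set i := ⌈Q * τs⌉₊ with hi
    have hpos : 0 < Q * τs := mul_pos hQ0 hτs.1
    have hi1 : i ∈ Finset.Icc 1 Q := by
      rw [Finset.mem_Icc]
      refine ⟨Nat.ceil_pos.2 hpos, Nat.ceil_le.2 ?_⟩
      nlinarith [hτs.2]
    have h1 : Q * τs ≤ i := Nat.le_ceil _
    have h2 : (i : ℝ) < Q * τs + 1 := Nat.ceil_lt_add_one hpos.le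
    have h3 := hupp _ (hgrid i hi1)
    have h4 : ((i : ℝ) / Q - τs) ^ 2 ≤ 1 / (Q : ℝ) ^ 2 := by
      rw [show (i : ℝ) / Q - τs = (i - Q * τs) / Q by field_simp, div_pow]
      gcongr
      nlinarith
    have h5 := hbest i hi1
    have h6 : C * ((i : ℝ) / Q - τs) ^ 2 ≤ C * (1 / (Q : ℝ) ^ 2) := by gcongr
    rw [mul_one_div] at h6
    linarith
  set M := min c C with hM
  have hM0 : 0 < M := lt_min hc hC
  have hw : ∀ i ∈ Finset.Icc 1 Q, C / (Q : ℝ) ^ 2 < f (b / Q) - f (i / Q) →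
      1 / (f (b / Q) - f (i / Q)) ≤ 3 / M * (Q : ℝ) ^ 2 * (1 / (1 + ((i : ℝ) - Q * τs) ^ 2)) := by
    intro i hi hgap
    set x := f (b / Q) - f (i / Q) with hx
    set z := ((i : ℝ) - Q * τs) ^ 2 with hz
    have hz0 : 0 ≤ z := sq_nonneg _
    have hCQ : 0 < C / (Q : ℝ) ^ 2 := by positivity
    have hx0 : 0 < x := hCQ.trans hgap
    have h1 := hlow _ (hgrid i hi)
    rw [show (i : ℝ) / Q - τs = (i - Q * τs) / Q by field_simp, div_pow, ← hz,
      mul_div_assoc'] at h1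
    have h2 : M / (Q : ℝ) ^ 2 * (1 + z) ≤ 3 * x := by
      have h3 : M / (Q : ℝ) ^ 2 ≤ C / (Q : ℝ) ^ 2 := by gcongr; exact min_le_right _ _
      have h4 : M / (Q : ℝ) ^ 2 * z ≤ c * z / (Q : ℝ) ^ 2 := by
        rw [div_mul_eq_mul_div]; gcongr; exact min_le_left _ _
      linarith
    rw [mul_one_div, le_div_iff₀ (by positivity), div_mul_eq_mul_div, one_mul,
      div_mul_eq_mul_div, div_le_div_iff₀ hx0 hM0]
    rw [div_mul_eq_mul_div, div_le_iff₀ (by positivity)] at h2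
    linarith
  have hmain := h.sum_gap_le hδ hQ hT hμ hb hbest (θ := C / (Q : ℝ) ^ 2) (by positivity)
    (fun i _ => by positivity) hw
  rw [← Finset.mul_sum] at hmain
  have hKs := hK (Q * τs) (Finset.Icc 1 Q)
  have hL : 0 ≤ Real.log T := Real.log_natCast_nonneg T
  have hKs' : 256 * Real.log T * (3 / M * (Q : ℝ) ^ 2 *
      ∑ i ∈ Finset.Icc 1 Q, 1 / (1 + ((i : ℝ) - Q * τs) ^ 2)) ≤
      256 * Real.log T * (3 / M * (Q : ℝ) ^ 2 * K) := by gcongr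
  have hsplit : ∑ t ∈ Finset.range T, (f τs - f (armAt T Q D δ r t / Q)) =
      T * (f τs - f (b / Q)) +
        ∑ t ∈ Finset.range T, (f (b / Q) - f (armAt T Q D δ r t / Q)) := by
    simp only [Finset.sum_sub_distrib, Finset.sum_const, Finset.card_range, nsmul_eq_mul]
    ring
  have hT0 : (0 : ℝ) ≤ T := Nat.cast_nonneg T
  have h1 : T * (f τs - f (b / Q)) ≤ T * (C / (Q : ℝ) ^ 2) := by gcongr
  have h2 : (T : ℝ) * (C / (Q : ℝ) ^ 2) = C * (T / (Q : ℝ) ^ 2) := by ring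
  have h3 : 256 * Real.log T * (3 / M * (Q : ℝ) ^ 2 * K) =
    768 / M * K * (Real.log T * (Q : ℝ) ^ 2) := by ring
  have h4 : T * (C / (Q : ℝ) ^ 2 + 8 * δ) = C * (T / (Q : ℝ) ^ 2) + 8 * (T * δ) := by ring
  rw [hsplit]
  linarith

end SuccessiveElimination

/-! ### Myopic best responses -/

namespace Realization

variable {A : Type*} (w : Realization A) (E : Set ℝ)

theorem bestResponses_nonempty [Finite A] : (w.bestResponses E).Nonempty := by
  obtain ⟨a, ha, hmax⟩ := Set.exists_max_image {b | w.Eligible E b} w.agentUtility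
    (Set.toFinite _) ⟨none, trivial⟩
  exact ⟨a, ha, hmax⟩

theorem bddAbove_image_bestResponses [Finite A] :
    BddAbove (w.principalUtility '' w.bestResponses E) :=
  (Set.toFinite _).bddAbove

variable {w}

theorem bestResponseValue_mem_Icc [Finite A] (hw : ∀ a, (w a).1 ∈ Icc (0 : ℝ) 1) :
    w.bestResponseValue E ∈ Icc (0 : ℝ) 1 := by
  have hu : ∀ a, w.principalUtility a ∈ Icc (0 : ℝ) 1 := by
    rintro (_ | a)
    · exact ⟨le_rfl, zero_le_one⟩
    · exact hw a
  obtain ⟨a, ha⟩ := w.bestResponses_nonempty E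
  refine ⟨(hu a).1.trans (le_csSup (w.bddAbove_image_bestResponses E) (mem_image_of_mem _ ha)), ?_⟩
  refine csSup_le ⟨_, mem_image_of_mem _ ha⟩ ?_
  rintro _ ⟨b, -, rfl⟩
  exact (hu b).2

theorem principalPayoff_mem_Icc (hw : ∀ a, (w a).1 ∈ Icc (0 : ℝ) 1) (a : Option A) :
    w.principalPayoff E a ∈ Icc (0 : ℝ) 1 := by
  unfold principalPayoff
  split_ifs
  · rcases a with _ | a
    · exact ⟨le_rfl, zero_le_one⟩
    · exact hw a
  · exact ⟨le_rfl, zero_le_one⟩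

theorem agentPayoff_mem_Icc (hw : ∀ a, (w a).2 ∈ Icc (0 : ℝ) 1) (a : Option A) :
    w.agentPayoff E a ∈ Icc (0 : ℝ) 1 := by
  unfold agentPayoff
  split_ifs
  · rcases a with _ | a
    · exact ⟨le_rfl, zero_le_one⟩
    · exact hw a
  · exact ⟨le_rfl, zero_le_one⟩

theorem principalUtility_eq_zero_of_eligible {E : Set ℝ} (hc : ∀ c, (w c).1 ∉ E) {b : Option A}
    (hb : w.Eligible E b) : w.principalUtility b = 0 := by
  rcases b with _ | b
  · rfl
  · exact absurd hb (hc b)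

theorem bestResponseValue_eq_zero [Finite A] {E : Set ℝ} (hc : ∀ c, (w c).1 ∉ E) :
    w.bestResponseValue E = 0 := by
  have : w.principalUtility '' w.bestResponses E = {0} := by
    refine ((w.bestResponses_nonempty E).image _).subset_singleton_iff.1 ?_
    rintro _ ⟨b, hb, rfl⟩
    exact principalUtility_eq_zero_of_eligible hc hb.1
  rw [bestResponseValue, this, csSup_singleton]

/-- By stochastic Lipschitz continuity, a proposal that is `ε`-optimal for the myopic agent yields
the principal the value of the best response, up to `ε / L₁`. -/
theorem abs_principalPayoff_sub_bestResponseValue_le [Finite A] {ymin L₁ ε : ℝ} (hε : 0 < ε)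
    (hεy : ε ≤ ymin) (hL₁ : 0 < L₁) (hy : ∀ a, ymin < (w a).2)
    (hLip : ∀ a b, L₁ * |(w a).1 - (w b).1| ≤ |(w a).2 - (w b).2|) {a : Option A}
    (ha : ∀ b, w.Eligible E b → w.agentUtility b ≤ w.agentPayoff E a + ε) :
    |w.principalPayoff E a - w.bestResponseValue E| ≤ ε / L₁ := by
  have hne : (w.principalUtility '' w.bestResponses E).Nonempty :=
    (w.bestResponses_nonempty E).image _
  by_cases hc : ∃ c, (w c).1 ∈ E
  · obtain ⟨c, hc⟩ := hc
    have hpos : 0 < w.agentPayoff E a := by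
      have := ha (some c) hc
      simp only [agentUtility] at this
      linarith [hy c]
    have hel : w.Eligible E a := by
      by_contra h
      rw [agentPayoff, if_neg h] at hpos
      exact lt_irrefl _ hpos
    rw [agentPayoff, if_pos hel] at hpos ha
    rw [principalPayoff, if_pos hel]
    rcases a with _ | a
    · exact absurd hpos (lt_irrefl _)
    have key : ∀ b ∈ w.bestResponses E, |w.principalUtility b - (w a).1| ≤ ε / L₁ := by
      rintro (_ | b) ⟨hb, hbest⟩
      · exact absurd (hbest (some c) hc) (not_le.2 (by
          simp only [agentUtility]; linarith [hy c]))
      · have h1 := hbest (some a) hel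
        have h2 := ha (some b) hb
        simp only [agentUtility] at h1 h2
        have h3 := hLip b a
        rw [abs_of_nonneg (sub_nonneg.2 h1)] at h3
        simp only [principalUtility]
        rw [le_div_iff₀' hL₁]
        linarith
    rw [abs_sub_comm, abs_sub_le_iff]
    simp only [principalUtility]
    constructor
    · rw [sub_le_iff_le_add]
      refine csSup_le hne ?_
      rintro _ ⟨b, hb, rfl⟩
      linarith [(abs_le.1 (key b hb)).2]
    · obtain ⟨b, hb⟩ := w.bestResponses_nonempty E
      have h1 := le_csSup (w.bddAbove_image_bestResponses E) (mem_image_of_mem _ hb)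
      have h2 := (abs_le.1 (key b hb)).1
      rw [bestResponseValue]
      linarith
  · push Not at hc
    have h1 : w.principalPayoff E a = 0 := by
      unfold principalPayoff
      split_ifs with h
      · exact principalUtility_eq_zero_of_eligible hc h
      · rfl
    rw [h1, bestResponseValue_eq_zero hc, sub_zero, abs_zero]
    positivity

theorem measurable_principalUtility (a : Option A) :
    Measurable fun w : Realization A => w.principalUtility a := by
  rcases a with _ | a
  · exact measurable_const
  · exact (measurable_pi_apply a).fst

theorem measurable_agentUtility (a : Option A) :
    Measurable fun w : Realization A => w.agentUtility a := by
  rcases a with _ | a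
  · exact measurable_const
  · exact (measurable_pi_apply a).snd

theorem measurable_eligible {Ω : Type*} {m : MeasurableSpace Ω} {w : Ω → Realization A}
    {τ : Ω → ℝ} (hw : Measurable w) (hτ : Measurable τ) (a : Option A) :
    MeasurableSet {ω | (w ω).Eligible (Ici (τ ω)) a} := by
  rcases a with _ | a
  · exact MeasurableSet.univ
  · exact measurableSet_le hτ ((measurable_pi_apply a).comp hw).fst

theorem measurable_bestResponseValue [Finite A] (τ : ℝ) :
    Measurable fun w : Realization A => w.bestResponseValue (Ici τ) := by
  have hel : ∀ a, MeasurableSet {w : Realization A | w.Eligible (Ici τ) a} :=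
    measurable_eligible measurable_id measurable_const
  refine measurable_of_Ioi fun x => ?_
  have : (fun w : Realization A => w.bestResponseValue (Ici τ)) ⁻¹' Ioi x =
      ⋃ a : Option A, ({w | w.Eligible (Ici τ) a} ∩
        ⋂ b : Option A, ({w | w.Eligible (Ici τ) b}ᶜ ∪ {w | w.agentUtility b ≤ w.agentUtility a})) ∩
        {w | x < w.principalUtility a} := by
    ext w
    rw [mem_preimage, mem_Ioi, bestResponseValue, lt_csSup_iff
      (w.bddAbove_image_bestResponses _) ((w.bestResponses_nonempty _).image _), exists_mem_image]
    simp only [mem_iUnion, mem_inter_iff, mem_iInter, mem_union, mem_compl_iff, mem_ofPred_eq,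
      bestResponses, imp_iff_not_or]
  rw [this]
  refine MeasurableSet.iUnion fun a => ((hel a).inter (MeasurableSet.iInter fun b => ?_)).inter ?_
  · exact (hel b).compl.union
      (measurableSet_le (measurable_agentUtility b) (measurable_agentUtility a))
  · exact measurableSet_lt measurable_const (measurable_principalUtility a)

/-- The payoffs are measurable when the realization, the threshold and the proposal are. -/
theorem measurable_payoff [Fintype A] {Ω : Type*} {m : MeasurableSpace Ω} {w : Ω → Realization A}
    {τ : Ω → ℝ} {σ : Ω → Option A} (hw : Measurable w) (hτ : Measurable τ)
    (hσ : ∀ a, MeasurableSet (σ ⁻¹' {a})) :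
    (Measurable fun ω => (w ω).principalPayoff (Ici (τ ω)) (σ ω)) ∧
      Measurable fun ω => (w ω).agentPayoff (Ici (τ ω)) (σ ω) := by
  classical
  have h1 : ∀ ω, (w ω).principalPayoff (Ici (τ ω)) (σ ω) =
      ∑ a, if ω ∈ σ ⁻¹' {a} ∩ {ω | (w ω).Eligible (Ici (τ ω)) a}
        then (w ω).principalUtility a else 0 := fun ω => by
    rw [Finset.sum_eq_single (σ ω)]
    · simp [principalPayoff]
    · intro b _ hb
      rw [if_neg fun h => hb h.1.symm]
    · simp
  have h2 : ∀ ω, (w ω).agentPayoff (Ici (τ ω)) (σ ω) =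
      ∑ a, if ω ∈ σ ⁻¹' {a} ∩ {ω | (w ω).Eligible (Ici (τ ω)) a}
        then (w ω).agentUtility a else 0 := fun ω => by
    rw [Finset.sum_eq_single (σ ω)]
    · simp [agentPayoff]
    · intro b _ hb
      rw [if_neg fun h => hb h.1.symm]
    · simp
  have hs : ∀ a, MeasurableSet (σ ⁻¹' {a} ∩ {ω | (w ω).Eligible (Ici (τ ω)) a}) := fun a =>
    (hσ a).inter (measurable_eligible hw hτ a)
  simp only [h1, h2]
  exact ⟨Finset.measurable_sum _ fun a _ =>
      Measurable.ite (hs a) ((measurable_principalUtility a).comp hw) measurable_const,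
    Finset.measurable_sum _ fun a _ =>
      Measurable.ite (hs a) ((measurable_agentUtility a).comp hw) measurable_const⟩

end Realization

/-! ### Measurability of the algorithm -/

namespace SuccessiveElimination

variable {T Q D : ℕ} {δ : ℝ} {Ω : Type*} {m : MeasurableSpace Ω} {r : ℕ → Ω → ℝ}

instance : Countable State :=
  Function.Injective.countable (f := fun s : State => (s.active, s.queue, s.pulls))
    fun s s' h => by
      cases s; cases s'
      simp only [Prod.mk.injEq] at h
      obtain ⟨rfl, rfl, rfl⟩ := h
      rfl

theorem measurableSet_survivors_eq {k : ℕ} (hr : ∀ s < k, Measurable (r s)) (p : List ℕ)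
    (S S' : Finset ℕ) :
    MeasurableSet {ω | survivors T δ (fun s => r s ω) p k S = S'} := by
  classical
  have hmean : ∀ i, Measurable fun ω => mean (fun s => r s ω) p k i := fun i => by
    refine (Finset.measurable_sum _ fun s hs => ?_).div_const _
    split_ifs
    · exact hr s (Finset.mem_range.1 hs)
    · exact measurable_const
  simp only [Finset.ext_iff, survivors, Finset.mem_filter]
  refine measurableSet_setOfPred.2 (Measurable.forall fun i => Measurable.iff ?_ measurable_const)
  refine Measurable.and measurable_const (Measurable.forall fun j => Measurable.imp
    measurable_const ?_)
  exact measurableSet_setOfPred.1 (measurableSet_le ((hmean j).sub_const _) ((hmean i).add_const _))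

theorem measurableSet_state_eq {t : ℕ} (hr : ∀ s < t, Measurable (r s)) (st : State) :
    MeasurableSet {ω | state T Q D δ (fun s => r s ω) t = st} := by
  induction t generalizing st with
  | zero => exact MeasurableSet.const (state T Q D δ (fun _ => 0) 0 = st)
  | succ t ih =>
    have ih := ih fun s hs => hr s (by omega)
    have : {ω | state T Q D δ (fun s => r s ω) (t + 1) = st} =
        ⋃ st' : State, {ω | state T Q D δ (fun s => r s ω) t = st'} ∩
          {ω | state T Q D δ (fun s => r s ω) (t + 1) = st} := by
      ext ω; simp
    rw [this]
    refine MeasurableSet.iUnion fun st' => ?_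
    rcases hq : st'.queue.tail with _ | ⟨i, q⟩
    · set pulls := st'.pulls ++ [st'.queue.headD 1]
      have : {ω | state T Q D δ (fun s => r s ω) t = st'} ∩
          {ω | state T Q D δ (fun s => r s ω) (t + 1) = st} =
          {ω | state T Q D δ (fun s => r s ω) t = st'} ∩ ⋃ S' : Finset ℕ,
            {ω | (if D < t + 1 then survivors T δ (fun s => r s ω) pulls (t + 1 - D) st'.active
              else st'.active) = S'} ∩
            {_ω | (⟨S', S'.sort (· ≤ ·), pulls⟩ : State) = st} := by
        ext ω
        simp only [mem_inter_iff, mem_ofPred_eq, mem_iUnion, exists_eq_left']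
        refine and_congr_right fun h => ?_
        rw [state_succ_of_tail_eq_nil (h ▸ hq), h]
      rw [this]
      refine (ih st').inter (MeasurableSet.iUnion fun S' =>
        MeasurableSet.inter ?_ (MeasurableSet.const _))
      split_ifs
      · exact measurableSet_survivors_eq (fun s hs => hr s (by omega)) _ _ _
      · exact MeasurableSet.const _
    · have : {ω | state T Q D δ (fun s => r s ω) t = st'} ∩
          {ω | state T Q D δ (fun s => r s ω) (t + 1) = st} =
          {ω | state T Q D δ (fun s => r s ω) t = st'} ∩
          {_ω | (⟨st'.active, i :: q, st'.pulls ++ [st'.queue.headD 1]⟩ : State) = st} := by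
        ext ω
        simp only [mem_inter_iff, mem_ofPred_eq]
        refine and_congr_right fun h => ?_
        rw [state_succ_of_tail_eq_cons (h ▸ hq), h]
      rw [this]
      exact (ih st').inter (MeasurableSet.const _)

theorem measurable_armAt {t : ℕ} (hr : ∀ s < t, Measurable (r s)) :
    Measurable fun ω => armAt T Q D δ (fun s => r s ω) t := by
  let : MeasurableSpace State := ⊤
  have h : Measurable fun ω => state T Q D δ (fun s => r s ω) t :=
    measurable_to_countable' fun st => measurableSet_state_eq hr st
  exact (measurable_from_top (f := fun st : State => st.queue.headD 1)).comp h

end SuccessiveElimination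

/-! ### The course of play -/

section Play

variable {A : Type*}

theorem reward_eq (M : Mechanism) (w : ℕ → Realization A) (a : ℕ → Option A) (t : ℕ) :
    reward M w a t = (w t).principalPayoff (announced M w a t) (a t) := by
  rw [reward, announced]

/-- The reward of a round depends only on the proposals made so far. -/
theorem reward_congr (M : Mechanism) (w : ℕ → Realization A) {a a' : ℕ → Option A} {t : ℕ}
    (h : ∀ s ≤ t, a s = a' s) : reward M w a t = reward M w a' t := by
  induction t using Nat.strong_induction_on with
  | _ t ih =>
    rw [reward_eq, reward_eq, h t le_rfl]
    have : announced M w a t = announced M w a' t := by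
      unfold announced
      congr 1
      funext s
      exact ih s s.2 fun k hk => h k (hk.trans s.2.le)
    rw [this]

open SuccessiveElimination in
theorem announced_mechanism (T Q D : ℕ) (δ : ℝ) (w : ℕ → Realization A) (a : ℕ → Option A)
    (t : ℕ) : announced (mechanism T Q D δ) w a t =
      Ici ((armAt T Q D δ (reward (mechanism T Q D δ) w a) t : ℝ) / Q) := by
  rw [announced, mechanism, arm_eq_armAt]

open SuccessiveElimination in
/-- The delay hides the proposal of round `t` from the announcements of the rounds up to
`t + D`. -/
theorem announced_mechanism_congr {T Q D : ℕ} {δ : ℝ} {w : ℕ → Realization A}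
    {a a' : ℕ → Option A} {t s : ℕ} (h : ∀ k < t, a k = a' k) (hs : s ≤ t + D) :
    announced (mechanism T Q D δ) w a s = announced (mechanism T Q D δ) w a' s := by
  rw [announced_mechanism, announced_mechanism, armAt_congr fun k hk =>
    reward_congr _ w fun l hl => h l (by omega)]

end Play

namespace DelegationProcess

variable {A : Type*} {I : DelegationInstance A} {Ω : Type*} [mΩ : MeasurableSpace Ω]
  {P : Measure Ω} (R : DelegationProcess I P)

/-- What the agent knows before he sees the utilities of round `t`. -/
abbrev past : ℕ → MeasurableSpace Ω
  | 0 => ⊥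
  | t + 1 => R.info t

theorem past_le_info (t : ℕ) : R.past t ≤ R.info t := by
  cases t with
  | zero => exact bot_le
  | succ t => exact R.info.mono (Nat.le_succ t)

theorem info_le_past {s t : ℕ} (h : s < t) : R.info s ≤ R.past t := by
  cases t with
  | zero => omega
  | succ t => exact R.info.mono (Nat.lt_succ_iff.1 h)

theorem past_mono {s t : ℕ} (h : s < t) : R.past s ≤ R.past t :=
  (R.past_le_info s).trans (R.info_le_past h)

theorem past_le (t : ℕ) : R.past t ≤ mΩ := (R.past_le_info t).trans (R.info.le t)

theorem measurable_w' (t : ℕ) : Measurable (R.w t) := (R.measurable_w t).mono (R.info.le t) le_rfl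

theorem indep_past [IsProbabilityMeasure P] (t : ℕ) :
    Indep (R.past t) (MeasurableSpace.comap (R.w t) inferInstance) P := by
  cases t with
  | zero => exact indep_bot_left _
  | succ t => exact R.indep t

theorem ae_of_ae_law {p : Realization A → Prop} (h : ∀ᵐ w ∂I.law, p w) :
    ∀ᵐ ω ∂P, ∀ t, p (R.w t ω) := by
  rw [ae_all_iff]
  intro t
  refine ae_of_ae_map (R.measurable_w' t).aemeasurable ?_
  rw [R.map_w t]
  exact h

theorem ae_mem_unit : ∀ᵐ ω ∂P, ∀ t a, (R.w t ω a).1 ∈ Icc (0 : ℝ) 1 ∧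
    (R.w t ω a).2 ∈ Icc (0 : ℝ) 1 :=
  R.ae_of_ae_law I.mem_unit

/-- The reward of the principal in round `t` against the policy `σ`, as a random variable. -/
noncomputable def rewardAt (M : Mechanism) (σ : ℕ → Ω → Option A) (t : ℕ) (ω : Ω) : ℝ :=
  reward M (fun t => R.w t ω) (fun t => σ t ω) t

/-- The arm that delayed successive elimination pulls in round `t` against the policy `σ`, as a
random variable. -/
noncomputable def pulledArm (T Q D : ℕ) (δ : ℝ) (σ : ℕ → Ω → Option A) (t : ℕ) (ω : Ω) : ℕ :=
  SuccessiveElimination.armAt T Q D δ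
    (fun s => R.rewardAt (SuccessiveElimination.mechanism T Q D δ) σ s ω) t

section Measurability

variable {T Q D : ℕ} {δ : ℝ} {σ : ℕ → Ω → Option A}

open SuccessiveElimination

theorem announced_eq (t : ℕ) (ω : Ω) :
    announced (mechanism T Q D δ) (fun t => R.w t ω) (fun t => σ t ω) t =
      Ici ((R.pulledArm T Q D δ σ t ω : ℝ) / Q) :=
  announced_mechanism ..

theorem measurable_rewardAt [Fintype A] (hσ : R.IsPolicy σ) (t : ℕ) :
    Measurable[R.info t] (R.rewardAt (mechanism T Q D δ) σ t) := by
  induction t using Nat.strong_induction_on with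
  | _ t ih =>
    have h1 : Measurable[R.info t] (R.pulledArm T Q D δ σ t) :=
      measurable_armAt (m := R.info t) fun s hs =>
        (ih s hs).mono (R.info.mono hs.le) le_rfl
    have h2 : Measurable[R.info t] fun ω => (R.pulledArm T Q D δ σ t ω : ℝ) / Q :=
      (measurable_from_top.comp h1).div_const _
    have h3 := (Realization.measurable_payoff (m := R.info t) (R.measurable_w t) h2 (hσ t)).1
    convert h3 using 2 with ω
    rw [rewardAt, reward_eq, announced_eq]

theorem measurable_pulledArm [Fintype A] (hσ : R.IsPolicy σ) (t : ℕ) :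
    Measurable[R.past t] (R.pulledArm T Q D δ σ t) :=
  measurable_armAt (m := R.past t) fun s hs =>
    (R.measurable_rewardAt hσ s).mono (R.info_le_past hs) le_rfl

theorem measurable_threshold [Fintype A] (hσ : R.IsPolicy σ) (t : ℕ) :
    Measurable[R.info t] fun ω => (R.pulledArm T Q D δ σ t ω : ℝ) / Q :=
  (measurable_from_top.comp
    ((R.measurable_pulledArm hσ t).mono (R.past_le_info t) le_rfl)).div_const _

theorem measurable_agentPayoff [Fintype A] (hσ : R.IsPolicy σ) (t : ℕ) :
    Measurable[R.info t] fun ω => (R.w t ω).agentPayoff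
      (announced (mechanism T Q D δ) (fun t => R.w t ω) (fun t => σ t ω) t) (σ t ω) := by
  simp only [announced_eq]
  exact (Realization.measurable_payoff (m := R.info t) (R.measurable_w t)
    (R.measurable_threshold hσ t) (hσ t)).2

theorem integrable_discountedUtility [Fintype A] [IsProbabilityMeasure P] (hσ : R.IsPolicy σ)
    (γ : ℝ) :
    Integrable (fun ω => discountedUtility (mechanism T Q D δ) γ T (fun t => R.w t ω)
      (fun t => σ t ω)) P := by
  unfold discountedUtility
  refine integrable_finsetSum _ fun t _ => Integrable.const_mul ?_ _
  refine Integrable.of_mem_Icc 0 1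
    ((R.measurable_agentPayoff hσ t).mono (R.info.le t) le_rfl).aemeasurable ?_
  filter_upwards [R.ae_mem_unit] with ω hω
  exact Realization.agentPayoff_mem_Icc _ (fun a => (hω t a).2) _

end Measurability

/-! ### A strategic agent is almost myopic -/

section Myopic

variable {T Q D : ℕ} {δ γ ε : ℝ} {σ : ℕ → Ω → Option A}

open SuccessiveElimination

/-- A deviation in a single round `t` that gains more than `ε` in this round raises the discounted
utility, since it changes the announcements of rounds after `t + D` only. -/
theorem discountedUtility_deviation (hγ : γ ∈ Ioo (0 : ℝ) 1) {w : ℕ → Realization A}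
    (hw : ∀ t a, (w t a).2 ∈ Icc (0 : ℝ) 1) {a a' : ℕ → Option A} {t : ℕ} (ht : t < T)
    (h : ∀ s, s ≠ t → a' s = a s)
    (hgain : (w t).agentPayoff (announced (mechanism T Q D δ) w a t) (a t) + ε ≤
      (w t).agentPayoff (announced (mechanism T Q D δ) w a t) (a' t)) :
    γ ^ t * (ε - γ ^ (D + 1) / (1 - γ)) ≤ discountedUtility (mechanism T Q D δ) γ T w a' -
      discountedUtility (mechanism T Q D δ) γ T w a := by
  have hγ0 := hγ.1.le
  rw [discountedUtility, discountedUtility, ← Finset.sum_sub_distrib]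
  have hann : ∀ s ≤ t + D, announced (mechanism T Q D δ) w a' s =
      announced (mechanism T Q D δ) w a s := fun s hs =>
    announced_mechanism_congr (fun k hk => h k hk.ne) hs
  have hterm : ∀ s, (if s = t then γ ^ t * ε else 0) - (if t + D + 1 ≤ s then γ ^ s else 0) ≤
      γ ^ s * (w s).agentPayoff (announced (mechanism T Q D δ) w a' s) (a' s) -
        γ ^ s * (w s).agentPayoff (announced (mechanism T Q D δ) w a s) (a s) := by
    intro s
    have hp : 0 ≤ γ ^ s := pow_nonneg hγ0 s
    rw [← mul_sub]
    by_cases hs : t + D + 1 ≤ s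
    · rw [if_neg (by omega), if_pos hs]
      have h1 := (Realization.agentPayoff_mem_Icc
        (announced (mechanism T Q D δ) w a' s) (hw s) (a' s)).1
      have h2 := (Realization.agentPayoff_mem_Icc
        (announced (mechanism T Q D δ) w a s) (hw s) (a s)).2
      nlinarith
    · rw [hann s (by omega), if_neg hs, sub_zero]
      by_cases hst : s = t
      · rw [if_pos hst, hst]
        refine mul_le_mul_of_nonneg_left ?_ (hst ▸ hp)
        linarith
      · rw [if_neg hst, h s hst, sub_self, mul_zero]
  refine le_trans ?_ (Finset.sum_le_sum fun s _ => hterm s)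
  rw [Finset.sum_sub_distrib, Finset.sum_ite_eq', if_pos (Finset.mem_range.2 ht),
    ← Finset.sum_filter]
  have hIco : (Finset.range T).filter (fun s => t + D + 1 ≤ s) = Finset.Ico (t + D + 1) T := by
    ext s; simp [and_comm]
  rw [hIco]
  have := geom_sum_Ico_le_of_lt_one (m := t + D + 1) (n := T) hγ0 hγ.2
  have h3 : γ ^ (t + D + 1) / (1 - γ) = γ ^ t * (γ ^ (D + 1) / (1 - γ)) := by
    rw [add_assoc, pow_add, mul_div_assoc]
  linarith

/-- A strategic agent proposes in every round a solution that is `ε`-optimal in this round: the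
utility that he may lose because of what his proposal reveals is delayed by more than `D` rounds,
and hence discounted below `ε`. -/
theorem IsStrategic.ae_near_optimal [Fintype A] [IsProbabilityMeasure P] {R : DelegationProcess I P}
    (hγ : γ ∈ Ioo (0 : ℝ) 1)
    (hD : γ ^ (D + 1) / (1 - γ) < ε) (hσ : R.IsStrategic (mechanism T Q D δ) γ T σ) {t : ℕ}
    (ht : t < T) :
    ∀ᵐ ω ∂P, ∀ b, (R.w t ω).Eligible
        (announced (mechanism T Q D δ) (fun t => R.w t ω) (fun t => σ t ω) t) b →
      (R.w t ω).agentUtility b ≤ (R.w t ω).agentPayoff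
        (announced (mechanism T Q D δ) (fun t => R.w t ω) (fun t => σ t ω) t) (σ t ω) + ε := by
  classical
  rw [ae_all_iff]
  intro b
  set B : Set Ω := {ω | (R.w t ω).Eligible
        (announced (mechanism T Q D δ) (fun t => R.w t ω) (fun t => σ t ω) t) b} ∩
      {ω | (R.w t ω).agentPayoff (announced (mechanism T Q D δ) (fun t => R.w t ω)
        (fun t => σ t ω) t) (σ t ω) + ε < (R.w t ω).agentUtility b} with hBdef
  have hB : MeasurableSet[R.info t] B := by
    refine MeasurableSet.inter ?_ ?_
    · simp only [announced_eq]
      exact Realization.measurable_eligible (m := R.info t) (R.measurable_w t)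
        (R.measurable_threshold hσ.1 t) b
    · exact @measurableSet_lt _ _ _ _ _ (R.info t) _ _ _ _ _
        (Measurable.add_const (R.measurable_agentPayoff hσ.1 t) _)
        ((Realization.measurable_agentUtility b).comp (R.measurable_w t))
  have hB' : MeasurableSet B := R.info.le t B hB
  -- The deviation: propose `b` in round `t` on the event `B`, and keep to `σ` otherwise.
  set σ' : ℕ → Ω → Option A := fun s ω => if s = t ∧ ω ∈ B then b else σ s ω with hσ'
  have hpol : R.IsPolicy σ' := by
    intro s a
    by_cases hs : s = t
    · subst hs
      have : σ' s ⁻¹' {a} = B.ite {_ω | b = a} (σ s ⁻¹' {a}) := by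
        ext ω
        by_cases hω : ω ∈ B <;> simp [hσ', Set.ite, hω]
      rw [this]
      exact MeasurableSet.ite hB (@MeasurableSet.const _ (R.info s) _) (hσ.1 s a)
    · have : σ' s = σ s := by
        funext ω; simp [hσ', hs]
      rw [this]
      exact hσ.1 s a
  set c := γ ^ t * (ε - γ ^ (D + 1) / (1 - γ)) with hc
  have hc0 : 0 < c := mul_pos (pow_pos hγ.1 t) (by linarith)
  have hint := R.integrable_discountedUtility (T := T) (Q := Q) (D := D) (δ := δ) hσ.1 γ
  have hint' := R.integrable_discountedUtility (T := T) (Q := Q) (D := D) (δ := δ) hpol γ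
  have hle : P.real B * c ≤ 0 := by
    calc P.real B * c = ∫ ω, B.indicator (fun _ => c) ω ∂P := by
          rw [integral_indicator_const _ hB', smul_eq_mul]
      _ ≤ ∫ ω, (discountedUtility (mechanism T Q D δ) γ T (fun t => R.w t ω) (fun t => σ' t ω) -
            discountedUtility (mechanism T Q D δ) γ T (fun t => R.w t ω) (fun t => σ t ω)) ∂P := by
          refine integral_mono_ae ((integrable_const c).indicator hB') (hint'.sub hint) ?_
          filter_upwards [R.ae_mem_unit] with ω hω
          by_cases hωB : ω ∈ B
          · rw [indicator_of_mem hωB]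
            refine discountedUtility_deviation hγ (fun s a => (hω s a).2) ht
              (fun s hs => if_neg fun h => hs h.1) ?_
            have h1 : σ' t ω = b := if_pos ⟨rfl, hωB⟩
            rw [h1]
            have h2 : _ + ε < (R.w t ω).agentUtility b := hωB.2
            refine h2.le.trans (le_of_eq ?_)
            rw [Realization.agentPayoff]
            exact (if_pos hωB.1).symm
          · rw [indicator_of_notMem hωB]
            have : (fun t => σ' t ω) = fun t => σ t ω := by
              funext s; exact if_neg fun h => hωB h.2
            rw [this, sub_self]
      _ = R.agentValue (mechanism T Q D δ) γ T σ' - R.agentValue (mechanism T Q D δ) γ T σ :=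
          integral_sub hint' hint
      _ ≤ 0 := sub_nonpos.2 (hσ.2 σ' hpol)
  have hP : P B = 0 := by
    rw [← measureReal_eq_zero_iff]
    exact le_antisymm (by nlinarith) measureReal_nonneg
  filter_upwards [measure_eq_zero_iff_ae_notMem.1 hP] with ω hω hel
  by_contra hlt
  exact hω ⟨hel, not_le.1 hlt⟩

end Myopic

end DelegationProcess

/-! ### Concentration of the observed values -/

namespace DelegationProcess

variable {A : Type*} {I : DelegationInstance A} {Ω : Type*} [mΩ : MeasurableSpace Ω]
  {P : Measure Ω} (R : DelegationProcess I P)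

theorem indepFun_past [IsProbabilityMeasure P] {t : ℕ} {X : Ω → ℝ} {φ : Realization A → ℝ}
    (hX : Measurable[R.past t] X) (hφ : Measurable φ) : IndepFun X (fun ω => φ (R.w t ω)) P := by
  rw [IndepFun_iff_Indep]
  refine indep_of_indep_of_le_left (indep_of_indep_of_le_right (R.indep_past t) ?_) hX.comap_le
  exact (Measurable.comap_le (hφ.comp (comap_measurable (R.w t))))

theorem integral_comp_w {g : Realization A → ℝ} (hg : Measurable g) (t : ℕ) :
    ∫ ω, g (R.w t ω) ∂P = ∫ w, g w ∂I.law := by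
  rw [← R.map_w t, integral_map (R.measurable_w' t).aemeasurable hg.aestronglyMeasurable]

/-- Hoeffding's lemma for the value of a round. -/
theorem integral_exp_le_one [IsProbabilityMeasure P] {g : Realization A → ℝ} (hg : Measurable g)
    (hg01 : ∀ᵐ w ∂I.law, g w ∈ Icc (0 : ℝ) 1) (t : ℕ) (l : ℝ) :
    ∫ ω, Real.exp (l * (g (R.w t ω) - ∫ w, g w ∂I.law) - l ^ 2 / 8) ∂P ≤ 1 := by
  have h := (hasSubgaussianMGF_of_mem_Icc (μ := P) (a := 0) (b := 1)
    (hg.comp (R.measurable_w' t)).aemeasurable (by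
      filter_upwards [R.ae_of_ae_law hg01] with ω hω using hω t)).mgf_le l
  simp only [Function.comp_apply, R.integral_comp_w hg, mgf] at h
  simp only [Real.exp_sub, integral_div]
  rw [div_le_one (Real.exp_pos _)]
  refine h.trans (le_of_eq ?_)
  congr 1
  simp only [sub_zero, nnnorm_one, NNReal.coe_pow, NNReal.coe_div, NNReal.coe_one,
    NNReal.coe_ofNat]
  ring

section Martingale

/-- The centred sum of the values `g` of the rounds before `t` selected by the events `V`. -/
noncomputable def selectedSum (g : Realization A → ℝ) (V : ℕ → Set Ω) (t : ℕ) (ω : Ω) : ℝ :=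
  ∑ s ∈ Finset.range t, (V s).indicator (fun ω => g (R.w s ω) - ∫ w, g w ∂I.law) ω

/-- The number of the rounds before `t` selected by the events `V`. -/
noncomputable def selectedCount (V : ℕ → Set Ω) (t : ℕ) (ω : Ω) : ℝ :=
  ∑ s ∈ Finset.range t, (V s).indicator (fun _ => (1 : ℝ)) ω

variable {R} {g : Realization A → ℝ} {V : ℕ → Set Ω}

theorem measurable_selectedSum (hg : Measurable g) (hV : ∀ s, MeasurableSet[R.past s] (V s))
    (t : ℕ) : Measurable[R.past t] (R.selectedSum g V t) := by
  refine @Finset.measurable_sum _ _ _ _ _ _ (R.past t) _ _ fun s hs => ?_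
  have hst := Finset.mem_range.1 hs
  refine Measurable.indicator (m := R.past t) ?_ (R.past_mono hst _ (hV s))
  exact ((hg.comp (R.measurable_w s)).mono (R.info_le_past hst) le_rfl).sub_const _

theorem measurable_selectedCount (hV : ∀ s, MeasurableSet[R.past s] (V s))
    (t : ℕ) : Measurable[R.past t] (selectedCount V t) := by
  refine @Finset.measurable_sum _ _ _ _ _ _ (R.past t) _ _ fun s hs => ?_
  exact Measurable.indicator (m := R.past t) measurable_const
    (R.past_mono (Finset.mem_range.1 hs) _ (hV s))

/-- The exponential supermartingale of a predictable selection of rounds. -/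
theorem integral_exp_selectedSum_le_one [IsProbabilityMeasure P] (hg : Measurable g)
    (hg01 : ∀ᵐ w ∂I.law, g w ∈ Icc (0 : ℝ) 1) (hV : ∀ s, MeasurableSet[R.past s] (V s)) (l : ℝ)
    (t : ℕ) :
    Integrable (fun ω => Real.exp (l * R.selectedSum g V t ω - l ^ 2 / 8 * selectedCount V t ω)) P ∧
    ∫ ω, Real.exp (l * R.selectedSum g V t ω - l ^ 2 / 8 * selectedCount V t ω) ∂P ≤ 1 := by
  induction t with
  | zero => simp [selectedSum, selectedCount]
  | succ t ih =>
    obtain ⟨hint, hle⟩ := ih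
    set F : Ω → ℝ := fun ω =>
      Real.exp (l * R.selectedSum g V t ω - l ^ 2 / 8 * selectedCount V t ω) with hF
    set y : Realization A → ℝ := fun w =>
      Real.exp (l * (g w - ∫ w, g w ∂I.law) - l ^ 2 / 8) with hy
    have hym : Measurable y := by fun_prop
    have hFm : Measurable[R.past t] F := Real.measurable_exp.comp
      (Measurable.sub (Measurable.const_mul (measurable_selectedSum hg hV t) _)
        (Measurable.const_mul (measurable_selectedCount hV t) _))
    have hVt : MeasurableSet (V t) := R.past_le t _ (hV t)
    have hFV : Measurable[R.past t] ((V t).indicator F) :=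
      Measurable.indicator (m := R.past t) hFm (hV t)
    have hind := R.indepFun_past hFV hym
    have hyint : Integrable (fun ω => y (R.w t ω)) P := by
      refine Integrable.of_mem_Icc 0 (Real.exp (|l| * 2))
        (hym.comp (R.measurable_w' t)).aemeasurable ?_
      have hμ : (∫ w, g w ∂I.law) ∈ Icc (0 : ℝ) 1 := by
        have := I.isProbabilityMeasure
        have hgi : Integrable g I.law := Integrable.of_mem_Icc 0 1 hg.aemeasurable hg01
        refine ⟨integral_nonneg_of_ae (hg01.mono fun w h => h.1), ?_⟩
        have := integral_mono_ae hgi (integrable_const (1 : ℝ)) (hg01.mono fun w h => h.2)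
        simpa using this
      filter_upwards [R.ae_of_ae_law hg01] with ω hω
      refine ⟨(Real.exp_pos _).le, Real.exp_le_exp.2 ?_⟩
      have h1 : |g (R.w t ω) - ∫ w, g w ∂I.law| ≤ 2 := by
        rw [abs_le]
        constructor <;> linarith [(hω t).1, (hω t).2, hμ.1, hμ.2]
      have h2 : l * (g (R.w t ω) - ∫ w, g w ∂I.law) ≤ |l| * 2 := by
        refine (le_abs_self _).trans ?_
        rw [abs_mul]
        gcongr
      nlinarith [sq_nonneg l]
    have hint1 : Integrable ((V t).indicator F) P := hint.indicator hVt
    have hint2 : Integrable ((V t)ᶜ.indicator F) P := hint.indicator hVt.compl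
    have hprod : Integrable (fun ω => (V t).indicator F ω * y (R.w t ω)) P :=
      hind.integrable_mul hint1 hyint
    have hstep : (fun ω => Real.exp (l * R.selectedSum g V (t + 1) ω -
        l ^ 2 / 8 * selectedCount V (t + 1) ω)) =
        fun ω => (V t)ᶜ.indicator F ω + (V t).indicator F ω * y (R.w t ω) := by
      funext ω
      simp only [selectedSum, selectedCount, Finset.sum_range_succ]
      by_cases hω : ω ∈ V t
      · rw [indicator_of_mem hω, indicator_of_mem hω, indicator_of_mem hω,
          indicator_of_notMem (not_not_intro hω), zero_add, hF, hy]
        simp only [selectedSum, selectedCount]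
        rw [← Real.exp_add]
        congr 1
        ring
      · rw [indicator_of_notMem hω, indicator_of_notMem hω, indicator_of_notMem hω,
          indicator_of_mem (mem_compl hω), zero_mul, add_zero, add_zero, add_zero]
        rfl
    rw [hstep]
    refine ⟨hint2.add hprod, ?_⟩
    rw [integral_add hint2 hprod, hind.integral_fun_mul_eq_mul_integral
      hint1.aestronglyMeasurable hyint.aestronglyMeasurable]
    have h1 := R.integral_exp_le_one hg hg01 t l
    have h2 : 0 ≤ ∫ ω, (V t).indicator F ω ∂P :=
      integral_nonneg fun ω => indicator_nonneg (fun _ _ => (Real.exp_pos _).le) _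
    have h3 : ∫ ω, (V t)ᶜ.indicator F ω ∂P + ∫ ω, (V t).indicator F ω ∂P = ∫ ω, F ω ∂P := by
      rw [← integral_add hint2 hint1]
      congr 1
      funext ω
      exact congrFun (indicator_compl_add_self (V t) F) ω
    calc _ ≤ ∫ ω, (V t)ᶜ.indicator F ω ∂P + (∫ ω, (V t).indicator F ω ∂P) * 1 := by
          gcongr
      _ ≤ 1 := by rw [mul_one, h3]; exact hle

/-- Chernoff's bound, for the event that exactly `n` rounds have been selected. -/
theorem measureReal_selectedSum_le [IsProbabilityMeasure P] (hg : Measurable g)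
    (hg01 : ∀ᵐ w ∂I.law, g w ∈ Icc (0 : ℝ) 1) (hV : ∀ s, MeasurableSet[R.past s] (V s))
    (t : ℕ) {n u : ℝ} (hn : 0 < n) (hu : 0 ≤ u) :
    P.real {ω | u ≤ |R.selectedSum g V t ω| ∧ selectedCount V t ω = n} ≤
      2 * Real.exp (-(2 * u ^ 2 / n)) := by
  -- The exponents `l = ± 4 u / n` optimize the bound; on the event, the exponential is at least
  -- `exp (l * u - l ^ 2 * n / 8) = exp (2 * u ^ 2 / n)`.
  have key : ∀ l : ℝ, P.real {ω | Real.exp (2 * u ^ 2 / n) ≤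
        Real.exp (l * R.selectedSum g V t ω - l ^ 2 / 8 * selectedCount V t ω)} ≤
        Real.exp (-(2 * u ^ 2 / n)) := by
    intro l
    obtain ⟨h1, h2⟩ := integral_exp_selectedSum_le_one hg hg01 hV l t
    have h3 := mul_meas_ge_le_integral_of_nonneg
      (Filter.Eventually.of_forall fun ω => (Real.exp_pos _).le) h1 (Real.exp (2 * u ^ 2 / n))
    rw [Real.exp_neg, ← one_div, le_div_iff₀' (Real.exp_pos _)]
    exact h3.trans h2
  have hsub : {ω | u ≤ |R.selectedSum g V t ω| ∧ selectedCount V t ω = n} ⊆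
      {ω | Real.exp (2 * u ^ 2 / n) ≤ Real.exp ((4 * u / n) * R.selectedSum g V t ω -
        (4 * u / n) ^ 2 / 8 * selectedCount V t ω)} ∪
      {ω | Real.exp (2 * u ^ 2 / n) ≤ Real.exp (-(4 * u / n) * R.selectedSum g V t ω -
        (-(4 * u / n)) ^ 2 / 8 * selectedCount V t ω)} := by
    rintro ω ⟨h1, h2⟩
    simp only [mem_union, mem_ofPred_eq, Real.exp_le_exp, h2]
    have hl : 0 ≤ 4 * u / n := by positivity
    have he : 2 * u ^ 2 / n = (4 * u / n) * u - (4 * u / n) ^ 2 / 8 * n := by field_simp; ring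
    rw [he, neg_sq]
    rcases le_abs.1 h1 with h | h
    · left; nlinarith
    · right; nlinarith
  calc _ ≤ _ := measureReal_mono hsub
    _ ≤ _ := measureReal_union_le _ _
    _ ≤ _ := by linarith [key (4 * u / n), key (-(4 * u / n))]

end Martingale

end DelegationProcess

/-! ### Validity of the confidence intervals -/

namespace SuccessiveElimination

/-- Stopping the selection of the pulls of arm `i` once there are as many as before round `m`
gives the pulls before round `m`. -/
theorem sum_ite_numPulls_lt (a : ℕ → ℕ) {m T : ℕ} (h : m ≤ T) (i : ℕ) (x : ℕ → ℝ) :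
    (∑ s ∈ Finset.range T, if a s = i ∧ numPulls a s i < numPulls a m i then x s else 0) =
      ∑ s ∈ Finset.range m, if a s = i then x s else 0 := by
  rw [← Finset.sum_subset (Finset.range_subset_range.2 h)]
  · refine Finset.sum_congr rfl fun s hs => if_congr ?_ rfl rfl
    refine and_iff_left_of_imp fun hsi => ?_
    have h1 := numPulls_mono a i (Nat.succ_le_of_lt (Finset.mem_range.1 hs))
    simp only [Nat.succ_eq_add_one, numPulls_succ, if_pos hsi] at h1
    omega
  · intro s _ hs
    rw [if_neg]
    rintro ⟨-, hlt⟩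
    exact absurd (numPulls_mono a i (not_lt.1 fun h => hs (Finset.mem_range.2 h))) (not_le.2 hlt)

theorem cast_numPulls (a : ℕ → ℕ) (m i : ℕ) :
    (numPulls a m i : ℝ) = ∑ s ∈ Finset.range m, if a s = i then (1 : ℝ) else 0 := by
  rw [numPulls]; push_cast; rfl

end SuccessiveElimination

namespace DelegationInstance

variable {A : Type*} [Finite A] (I : DelegationInstance A)

theorem ae_bestResponseValue_mem_Icc (E : Set ℝ) :
    ∀ᵐ w ∂I.law, w.bestResponseValue E ∈ Icc (0 : ℝ) 1 :=
  I.mem_unit.mono fun _ hw => Realization.bestResponseValue_mem_Icc E fun a => (hw a).1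

theorem thresholdValue_mem_Icc (τ : ℝ) : I.thresholdValue τ ∈ Icc (0 : ℝ) 1 := by
  have := I.isProbabilityMeasure
  have h := I.ae_bestResponseValue_mem_Icc (Ici τ)
  have hint : Integrable (fun w => w.bestResponseValue (Ici τ)) I.law :=
    Integrable.of_mem_Icc 0 1 (Realization.measurable_bestResponseValue τ).aemeasurable h
  refine ⟨integral_nonneg_of_ae (h.mono fun w h => h.1), ?_⟩
  have := integral_mono_ae hint (integrable_const (1 : ℝ)) (h.mono fun w h => h.2)
  simpa [thresholdValue] using this

end DelegationInstance

namespace DelegationProcess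

open SuccessiveElimination

variable {A : Type*} {I : DelegationInstance A} {Ω : Type*} [mΩ : MeasurableSpace Ω]
  {P : Measure Ω} (R : DelegationProcess I P)

/-- Arm `i` is pulled in round `s`, and it has been pulled fewer than `n` times before. -/
def pullEvent (T Q D : ℕ) (δ : ℝ) (σ : ℕ → Ω → Option A) (i n s : ℕ) : Set Ω :=
  {ω | R.pulledArm T Q D δ σ s ω = i ∧
    numPulls (fun k => R.pulledArm T Q D δ σ k ω) s i < n}

/-- The event that the first `n` pulls of some arm yield a mean outside of the confidence
interval. -/
def badEvent (T Q D : ℕ) (δ : ℝ) (σ : ℕ → Ω → Option A) : Set Ω :=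
  ⋃ i ∈ Finset.Icc 1 Q, ⋃ n ∈ Finset.Icc 1 T,
    {ω | √(2 * Real.log T * n) ≤ |R.selectedSum (fun w => w.bestResponseValue (Ici ((i : ℝ) / Q)))
      (R.pullEvent T Q D δ σ i n) T ω| ∧ selectedCount (R.pullEvent T Q D δ σ i n) T ω = n}

variable {R} {T Q D : ℕ} {δ : ℝ} {σ : ℕ → Ω → Option A}

theorem measurableSet_pullEvent [Fintype A] (hσ : R.IsPolicy σ) (i n s : ℕ) :
    MeasurableSet[R.past s] (R.pullEvent T Q D δ σ i n s) := by
  have h1 : ∀ k ≤ s, MeasurableSet[R.past s] {ω | R.pulledArm T Q D δ σ k ω = i} := fun k hk =>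
    ((R.measurable_pulledArm hσ k).mono
      (hk.eq_or_lt.elim (fun h => h ▸ le_rfl) R.past_mono) le_rfl)
      (measurableSet_singleton i)
  refine MeasurableSet.inter (h1 s le_rfl) ?_
  have h2 : Measurable[R.past s] fun ω => numPulls (fun k => R.pulledArm T Q D δ σ k ω) s i :=
    Finset.measurable_sum (m := R.past s) _ fun k hk =>
      Measurable.ite (h1 k (Finset.mem_range.1 hk).le) measurable_const measurable_const
  exact h2 (measurableSet_Iio (a := n))

theorem selectedCount_pullEvent {ω : Ω} {m : ℕ} (hm : m ≤ T) (i : ℕ) :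
    selectedCount (R.pullEvent T Q D δ σ i
      (numPulls (fun k => R.pulledArm T Q D δ σ k ω) m i)) T ω =
      numPulls (fun k => R.pulledArm T Q D δ σ k ω) m i := by
  classical
  rw [cast_numPulls, ← sum_ite_numPulls_lt _ hm]
  refine Finset.sum_congr rfl fun s _ => ?_
  rw [indicator_apply]
  exact if_congr Iff.rfl rfl rfl

theorem selectedSum_pullEvent {ω : Ω} {m : ℕ} (hm : m ≤ T) (i : ℕ) (g : Realization A → ℝ) :
    R.selectedSum g (R.pullEvent T Q D δ σ i
      (numPulls (fun k => R.pulledArm T Q D δ σ k ω) m i)) T ω =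
      ∑ s ∈ Finset.range m, if R.pulledArm T Q D δ σ s ω = i then
        g (R.w s ω) - ∫ w, g w ∂I.law else 0 := by
  classical
  rw [← sum_ite_numPulls_lt (fun k => R.pulledArm T Q D δ σ k ω) hm]
  refine Finset.sum_congr rfl fun s _ => ?_
  rw [indicator_apply]
  exact if_congr Iff.rfl rfl rfl

theorem measureReal_badEvent_le [Fintype A] [IsProbabilityMeasure P] (hσ : R.IsPolicy σ)
    (hT : 2 ≤ T) (hQT : Q ≤ T) : T * P.real (R.badEvent T Q D δ σ) ≤ 1 := by
  have hT2 : (2 : ℝ) ≤ T := by exact_mod_cast hT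
  have hT0 : (0 : ℝ) < T := by linarith
  have hL : 0 ≤ Real.log T := Real.log_natCast_nonneg T
  have h1 : ∀ i : ℕ, ∀ n ∈ Finset.Icc 1 T,
      P.real {ω | √(2 * Real.log T * n) ≤
        |R.selectedSum (fun w => w.bestResponseValue (Ici ((i : ℝ) / Q)))
          (R.pullEvent T Q D δ σ i n) T ω| ∧ selectedCount (R.pullEvent T Q D δ σ i n) T ω = n} ≤
        2 / (T : ℝ) ^ 4 := by
    intro i n hn
    have hn0 : (0 : ℝ) < n := by exact_mod_cast (Finset.mem_Icc.1 hn).1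
    refine (measureReal_selectedSum_le (Realization.measurable_bestResponseValue _)
      (I.ae_bestResponseValue_mem_Icc _) (measurableSet_pullEvent hσ i n) T hn0
      (Real.sqrt_nonneg _)).trans (le_of_eq ?_)
    rw [Real.sq_sqrt (by positivity), show 2 * (2 * Real.log T * n) / (n : ℝ) = 4 * Real.log T by
      field_simp; ring, Real.exp_neg, div_eq_mul_inv]
    congr 2
    rw [show 4 * Real.log T = ((4 : ℕ) : ℝ) * Real.log T by norm_num, Real.exp_nat_mul,
      Real.exp_log hT0]
  have h2 : P.real (R.badEvent T Q D δ σ) ≤ Q * (T * (2 / (T : ℝ) ^ 4)) := by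
    calc _ ≤ ∑ i ∈ Finset.Icc 1 Q, ∑ n ∈ Finset.Icc 1 T, 2 / (T : ℝ) ^ 4 := by
          refine (measureReal_biUnion_finset_le _ _).trans (Finset.sum_le_sum fun i _ => ?_)
          exact (measureReal_biUnion_finset_le _ _).trans (Finset.sum_le_sum (h1 i))
      _ = _ := by simp
  have hQT' : (Q : ℝ) ≤ T := by exact_mod_cast hQT
  calc _ ≤ (T : ℝ) * (T * (T * (2 / (T : ℝ) ^ 4))) := by
        gcongr
        exact h2.trans (by gcongr)
    _ = 2 / T := by field_simp
    _ ≤ 1 := by rw [div_le_one hT0]; exact hT2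

/-- Outside of the bad event, the empirical means of rewards that are within `δ` of the value of
the myopic best response obey the confidence bounds with perturbation `δ`. -/
theorem confidenceValid_of_notMem_badEvent [Finite A] (hT : 2 ≤ T) (hδ : 0 ≤ δ) {ω : Ω}
    (hω : ω ∉ R.badEvent T Q D δ σ)
    (hclose : ∀ t < T, |R.rewardAt (mechanism T Q D δ) σ t ω -
      (R.w t ω).bestResponseValue (Ici ((R.pulledArm T Q D δ σ t ω : ℝ) / Q))| ≤ δ) :
    ConfidenceValid T Q D δ (fun s => R.rewardAt (mechanism T Q D δ) σ s ω)
      (fun i => I.thresholdValue (i / Q)) := by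
  intro i hi m hm
  set a : ℕ → ℕ := fun k => R.pulledArm T Q D δ σ k ω with ha
  change |(∑ s ∈ Finset.range m, if a s = i then R.rewardAt (mechanism T Q D δ) σ s ω else 0) /
    (max (numPulls a m i) 1 : ℕ) - I.thresholdValue (i / Q)| ≤
      √(2 * Real.log T / (max (numPulls a m i) 1 : ℕ)) + δ
  have hf := I.thresholdValue_mem_Icc (i / Q)
  rcases Nat.eq_zero_or_pos (numPulls a m i) with h0 | hpos
  · -- Without pulls the mean is `0`, and the radius exceeds `√(2 log 2) > 1`.
    have h1 : (∑ s ∈ Finset.range m, if a s = i then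
        R.rewardAt (mechanism T Q D δ) σ s ω else 0) = 0 := by
      refine Finset.sum_eq_zero fun s hs => if_neg fun hsi => ?_
      have := Finset.sum_eq_zero_iff.1 h0 s hs
      rw [if_pos hsi] at this
      exact one_ne_zero this
    have h2 : (1 : ℝ) ≤ √(2 * Real.log T) := by
      refine Real.one_le_sqrt.2 ?_
      have : Real.log 2 ≤ Real.log T := Real.log_le_log (by norm_num) (by exact_mod_cast hT)
      linarith [Real.log_two_gt_d9]
    rw [h1, h0, zero_div, zero_sub, abs_neg, abs_of_nonneg hf.1, show max 0 1 = 1 from rfl,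
      Nat.cast_one, div_one]
    linarith [hf.2]
  · have hnT : numPulls a m i ∈ Finset.Icc 1 T :=
      Finset.mem_Icc.2 ⟨hpos, (numPulls_le a m i).trans hm⟩
    have hdev : |R.selectedSum (fun w => w.bestResponseValue (Ici ((i : ℝ) / Q)))
        (R.pullEvent T Q D δ σ i (numPulls a m i)) T ω| < √(2 * Real.log T * numPulls a m i) := by
      by_contra! hge
      refine hω ?_
      simp only [badEvent, mem_iUnion]
      exact ⟨i, hi, numPulls a m i, hnT, hge, selectedCount_pullEvent hm i⟩
    rw [selectedSum_pullEvent hm] at hdev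
    change |∑ s ∈ Finset.range m, if a s = i then
      (R.w s ω).bestResponseValue (Ici ((i : ℝ) / Q)) - I.thresholdValue (i / Q) else 0| < _ at hdev
    rw [max_eq_left (Nat.succ_le_of_lt hpos)]
    have hn0 : (0 : ℝ) < numPulls a m i := by exact_mod_cast hpos
    set n : ℝ := (↑(numPulls a m i) : ℝ) with hn
    have hsplit : (∑ s ∈ Finset.range m, if a s = i then
        R.rewardAt (mechanism T Q D δ) σ s ω else 0) - n * I.thresholdValue (i / Q) =
        (∑ s ∈ Finset.range m, if a s = i then R.rewardAt (mechanism T Q D δ) σ s ω -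
          (R.w s ω).bestResponseValue (Ici ((i : ℝ) / Q)) else 0) +
        ∑ s ∈ Finset.range m, if a s = i then
          (R.w s ω).bestResponseValue (Ici ((i : ℝ) / Q)) - I.thresholdValue (i / Q) else 0 := by
      rw [hn, cast_numPulls, Finset.sum_mul, ← Finset.sum_sub_distrib, ← Finset.sum_add_distrib]
      refine Finset.sum_congr rfl fun s _ => ?_
      split_ifs <;> ring
    have hpert : |∑ s ∈ Finset.range m, if a s = i then R.rewardAt (mechanism T Q D δ) σ s ω -
          (R.w s ω).bestResponseValue (Ici ((i : ℝ) / Q)) else 0| ≤ n * δ := by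
      refine (Finset.abs_sum_le_sum_abs _ _).trans ?_
      rw [hn, cast_numPulls, Finset.sum_mul]
      refine Finset.sum_le_sum fun s hs => ?_
      split_ifs with hsi
      · have := hclose s ((Finset.mem_range.1 hs).trans_le hm)
        rw [one_mul, ← hsi]
        exact this
      · simp
    have hsqrt : √(2 * Real.log T * n) / n = √(2 * Real.log T / n) := by
      rw [Real.sqrt_mul' _ hn0.le, Real.sqrt_div' _ hn0.le, mul_div_assoc, Real.sqrt_div_self']
      ring
    rw [← mul_div_cancel_left₀ (I.thresholdValue (i / Q)) hn0.ne', ← sub_div, abs_div,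
      abs_of_pos hn0, hsplit, ← hsqrt, div_le_iff₀ hn0, add_mul, div_mul_cancel₀ _ hn0.ne']
    refine (abs_add_le _ _).trans ?_
    linarith

/-! ### The regret -/

/-- Since the arm of a round is independent of the utilities of this round, the expected value of
the myopic best response in the round is the expected objective at the threshold announced. -/
theorem integral_bestResponseValue_pulledArm [Fintype A] [IsProbabilityMeasure P]
    (hσ : R.IsPolicy σ) (hδ : 0 ≤ δ) (hQ : 1 ≤ Q) (t : ℕ) :
    ∫ ω, (R.w t ω).bestResponseValue (Ici ((R.pulledArm T Q D δ σ t ω : ℝ) / Q)) ∂P =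
      ∫ ω, I.thresholdValue (R.pulledArm T Q D δ σ t ω / Q) ∂P := by
  classical
  set b : ℕ → Ω → ℝ := fun i => (R.pulledArm T Q D δ σ t ⁻¹' {i}).indicator fun _ => 1 with hb
  have hsum : ∀ (ω : Ω) (x : ℕ → ℝ), x (R.pulledArm T Q D δ σ t ω) =
      ∑ i ∈ Finset.Icc 1 Q, b i ω * x i := by
    intro ω x
    rw [Finset.sum_eq_single (R.pulledArm T Q D δ σ t ω)]
    · simp [hb]
    · intro i _ hi
      simp [hb, hi.symm]
    · intro h
      exact absurd (armAt_mem_Icc hδ hQ t) h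
  have hbm : ∀ i, Measurable[R.past t] (b i) := fun i =>
    Measurable.indicator (m := R.past t) measurable_const
      (R.measurable_pulledArm hσ t (measurableSet_singleton i))
  have hbint : ∀ i, Integrable (b i) P := fun i =>
    Integrable.of_mem_Icc 0 1 ((hbm i).mono (R.past_le t) le_rfl).aemeasurable
      (Filter.Eventually.of_forall fun ω => by
        simp only [hb, indicator_apply]; split_ifs <;> simp)
  have hgint : ∀ i : ℕ, Integrable
      (fun ω => (R.w t ω).bestResponseValue (Ici ((i : ℝ) / Q))) P := fun i =>
    Integrable.of_mem_Icc 0 1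
      ((Realization.measurable_bestResponseValue _).comp (R.measurable_w' t)).aemeasurable
      ((R.ae_of_ae_law (I.ae_bestResponseValue_mem_Icc _)).mono fun ω h => h t)
  have hind : ∀ i : ℕ, IndepFun (b i)
      (fun ω => (R.w t ω).bestResponseValue (Ici ((i : ℝ) / Q))) P := fun i =>
    R.indepFun_past (hbm i) (Realization.measurable_bestResponseValue _)
  have h1 := fun ω => hsum ω fun i => (R.w t ω).bestResponseValue (Ici ((i : ℝ) / Q))
  have h2 := fun ω => hsum ω fun i => I.thresholdValue (i / Q)
  beta_reduce at h1 h2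
  simp only [h1, h2]
  have hprod : ∀ i : ℕ, Integrable
      (fun ω => b i ω * (R.w t ω).bestResponseValue (Ici ((i : ℝ) / Q))) P := fun i =>
    (hind i).integrable_mul (hbint i) (hgint i)
  rw [integral_finsetSum _ fun i _ => hprod i,
    integral_finsetSum _ fun i _ => (hbint i).mul_const _]
  refine Finset.sum_congr rfl fun i _ => ?_
  rw [(hind i).integral_fun_mul_eq_mul_integral (hbint i).aestronglyMeasurable
    (hgint i).aestronglyMeasurable, integral_mul_const,
    R.integral_comp_w (Realization.measurable_bestResponseValue _)]
  rfl

/-- The regret is at most a bound that holds for successive elimination whenever the confidence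
intervals are valid, up to a constant. -/
theorem regret_le_of_confidenceValid [Fintype A] [IsProbabilityMeasure P] (hσ : R.IsPolicy σ)
    (hT : 2 ≤ T) (hQ : 1 ≤ Q) (hQT : Q ≤ T) (hδ : 0 ≤ δ) (hδT : T * δ ≤ 1)
    (hclose : ∀ᵐ ω ∂P, ∀ t < T, |R.rewardAt (mechanism T Q D δ) σ t ω -
      (R.w t ω).bestResponseValue (Ici ((R.pulledArm T Q D δ σ t ω : ℝ) / Q))| ≤ δ)
    {M B : ℝ} (hM : I.opt T = T * M) (hM1 : M ≤ 1) (hB : 0 ≤ B)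
    (hbound : ∀ r, ConfidenceValid T Q D δ r (fun i => I.thresholdValue (i / Q)) →
      ∑ t ∈ Finset.range T, (M - I.thresholdValue (armAt T Q D δ r t / Q)) ≤ B) :
    R.regret (mechanism T Q D δ) T σ ≤ B + 2 := by
  classical
  have hmeas : ∀ t, Measurable (R.rewardAt (mechanism T Q D δ) σ t) := fun t =>
    (R.measurable_rewardAt hσ t).mono (R.info.le t) le_rfl
  have harm : ∀ t, Measurable (R.pulledArm T Q D δ σ t) := fun t =>
    (R.measurable_pulledArm hσ t).mono (R.past_le t) le_rfl
  have hrint : ∀ t, Integrable (R.rewardAt (mechanism T Q D δ) σ t) P := fun t => by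
    refine Integrable.of_mem_Icc 0 1 (hmeas t).aemeasurable ?_
    filter_upwards [R.ae_mem_unit] with ω hω
    rw [rewardAt, reward_eq]
    exact Realization.principalPayoff_mem_Icc _ (fun a => (hω t a).1) _
  have hfm : ∀ t, Measurable fun ω => I.thresholdValue (R.pulledArm T Q D δ σ t ω / Q) :=
    fun t => (measurable_from_top (f := fun i : ℕ => I.thresholdValue (i / Q))).comp (harm t)
  have hfint : ∀ t, Integrable (fun ω => I.thresholdValue (R.pulledArm T Q D δ σ t ω / Q)) P :=
    fun t => Integrable.of_mem_Icc 0 1 (hfm t).aemeasurable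
      (Filter.Eventually.of_forall fun ω => I.thresholdValue_mem_Icc _)
  have hround : ∀ t ∈ Finset.range T,
      ∫ ω, I.thresholdValue (R.pulledArm T Q D δ σ t ω / Q) ∂P - δ ≤
        ∫ ω, R.rewardAt (mechanism T Q D δ) σ t ω ∂P := by
    intro t ht
    rw [← integral_bestResponseValue_pulledArm hσ hδ hQ, sub_le_iff_le_add]
    have h1 : ∫ ω, (R.rewardAt (mechanism T Q D δ) σ t ω + δ) ∂P =
        ∫ ω, R.rewardAt (mechanism T Q D δ) σ t ω ∂P + δ := by
      rw [integral_add (hrint t) (integrable_const δ)]; simp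
    rw [← h1]
    refine integral_mono_of_nonneg ?_ ((hrint t).add (integrable_const δ)) ?_
    · filter_upwards [R.ae_mem_unit] with ω hω
      exact (Realization.bestResponseValue_mem_Icc _ fun a => (hω t a).1).1
    · filter_upwards [hclose] with ω hω
      linarith [(abs_le.1 (hω t (Finset.mem_range.1 ht))).1]
  set W : Ω → ℝ := fun ω =>
    ∑ t ∈ Finset.range T, (M - I.thresholdValue (R.pulledArm T Q D δ σ t ω / Q)) with hW
  have hterm : ∀ t ∈ Finset.range T, Integrable
      (fun ω => M - I.thresholdValue (R.pulledArm T Q D δ σ t ω / Q)) P := fun t _ =>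
    (integrable_const M).sub (hfint t)
  have hWint : Integrable W P := integrable_finsetSum _ hterm
  have hWI : ∫ ω, W ω ∂P = T * M -
      ∑ t ∈ Finset.range T, ∫ ω, I.thresholdValue (R.pulledArm T Q D δ σ t ω / Q) ∂P := by
    rw [integral_finsetSum _ hterm]
    simp only [fun t => integral_sub (integrable_const M) (hfint t), Finset.sum_sub_distrib]
    simp
  have hbad : MeasurableSet (R.badEvent T Q D δ σ) := by
    refine Finset.measurableSet_biUnion _ fun i _ => Finset.measurableSet_biUnion _ fun n _ => ?_
    have hV := measurableSet_pullEvent (R := R) (T := T) (Q := Q) (D := D) (δ := δ) hσ i n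
    refine MeasurableSet.inter ?_ ?_
    · exact measurableSet_le measurable_const ((measurable_selectedSum
        (Realization.measurable_bestResponseValue _) hV T).mono (R.past_le T) le_rfl).abs
    · exact ((measurable_selectedCount hV T).mono (R.past_le T) le_rfl)
        (measurableSet_singleton (n : ℝ))
  have hWle : ∫ ω, W ω ∂P ≤ B + T * P.real (R.badEvent T Q D δ σ) := by
    have h1 : ∫ ω, (B + (R.badEvent T Q D δ σ).indicator (fun _ => (T : ℝ)) ω) ∂P =
        B + T * P.real (R.badEvent T Q D δ σ) := by
      rw [integral_add (integrable_const _) ((integrable_const _).indicator hbad),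
        integral_indicator_const _ hbad]
      simp [mul_comm]
    rw [← h1]
    refine integral_mono_ae hWint
      ((integrable_const _).add ((integrable_const _).indicator hbad)) ?_
    filter_upwards [hclose] with ω hω
    by_cases hωb : ω ∈ R.badEvent T Q D δ σ
    · rw [indicator_of_mem hωb]
      have : W ω ≤ ∑ t ∈ Finset.range T, (1 : ℝ) := Finset.sum_le_sum fun t _ => by
        linarith [(I.thresholdValue_mem_Icc (R.pulledArm T Q D δ σ t ω / Q)).1]
      simp only [Finset.sum_const, Finset.card_range, nsmul_eq_mul, mul_one] at this
      linarith
    · rw [indicator_of_notMem hωb, add_zero]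
      exact hbound _ (confidenceValid_of_notMem_badEvent hT hδ hωb hω)
  have hsumr : ∫ ω, ∑ t ∈ Finset.range T,
      reward (mechanism T Q D δ) (fun t => R.w t ω) (fun t => σ t ω) t ∂P =
      ∑ t ∈ Finset.range T, ∫ ω, R.rewardAt (mechanism T Q D δ) σ t ω ∂P :=
    integral_finsetSum _ fun t _ => hrint t
  have hsumle := Finset.sum_le_sum hround
  rw [Finset.sum_sub_distrib] at hsumle
  simp only [Finset.sum_const, Finset.card_range, nsmul_eq_mul] at hsumle
  have hPbad := measureReal_badEvent_le (R := R) (D := D) (δ := δ) hσ hT hQT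
  rw [regret, hM, hsumr]
  linarith

end DelegationProcess

/-! ### The tuning of the delay -/

/-- The delay discounts the total utility of all later rounds below `ε`. -/
theorem pow_delay_div_lt {γ ε : ℝ} (hγ : γ ∈ Ioo (0 : ℝ) 1) (hε : 0 < ε) {D : ℕ}
    (hD : effectiveHorizon γ * Real.log (effectiveHorizon γ / ε) ≤ D) :
    γ ^ (D + 1) / (1 - γ) < ε := by
  have h1 : 0 < 1 - γ := by linarith [hγ.2]
  have hH : 0 < effectiveHorizon γ := one_div_pos.2 h1
  have hHγ : effectiveHorizon γ * (1 - γ) = 1 := one_div_mul_cancel h1.ne'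
  have h2 : Real.log (effectiveHorizon γ / ε) ≤ (1 - γ) * D := by
    calc Real.log (effectiveHorizon γ / ε)
        = (1 - γ) * (effectiveHorizon γ * Real.log (effectiveHorizon γ / ε)) := by
          rw [← mul_assoc, mul_comm (1 - γ), hHγ, one_mul]
      _ ≤ _ := by gcongr
  have h3 : γ ≤ Real.exp (-(1 - γ)) := by linarith [Real.add_one_le_exp (-(1 - γ))]
  have h4 : γ ^ D ≤ ε * (1 - γ) := by
    calc γ ^ D ≤ Real.exp (-(1 - γ)) ^ D := pow_le_pow_left₀ hγ.1.le h3 D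
      _ = Real.exp (-((1 - γ) * D)) := by rw [← Real.exp_nat_mul]; congr 1; ring
      _ ≤ Real.exp (-Real.log (effectiveHorizon γ / ε)) :=
          Real.exp_le_exp.2 (neg_le_neg h2)
      _ = ε * (1 - γ) := by
          rw [Real.exp_neg, Real.exp_log (by positivity), inv_div, effectiveHorizon,
            div_div_eq_mul_div, div_one]
  rw [div_lt_iff₀ h1, pow_succ]
  have : 0 < ε * (1 - γ) := mul_pos hε h1
  calc γ ^ D * γ ≤ ε * (1 - γ) * γ := mul_le_mul_of_nonneg_right h4 hγ.1.le
    _ < ε * (1 - γ) * 1 := by gcongr; exact hγ.2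
    _ = _ := mul_one _

namespace DelegationInstance

variable {A : Type*} (I : DelegationInstance A)

theorem thresholdValue_eq_zero [IsEmpty A] (τ : ℝ) : I.thresholdValue τ = 0 := by
  simp only [thresholdValue, Realization.bestResponseValue_eq_zero (E := Ici τ)
    fun c : A => isEmptyElim c, integral_zero]

variable {I}

theorem AgentUtilityGT.lt_one [Nonempty A] {ymin : ℝ} (h : I.AgentUtilityGT ymin) : ymin < 1 := by
  have := I.isProbabilityMeasure
  obtain ⟨w, h1, h2⟩ := (I.mem_unit.and h).exists
  obtain ⟨a⟩ := ‹Nonempty A›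
  exact (h2 a).trans_le (h1 a).2.2

end DelegationInstance

namespace DelegationProcess

open SuccessiveElimination

variable {A : Type*} [Fintype A] {I : DelegationInstance A} {Ω : Type*} [mΩ : MeasurableSpace Ω]
  {P : Measure Ω} [IsProbabilityMeasure P] {R : DelegationProcess I P}
  {T Q D : ℕ} {δ γ ε L₁ ymin : ℝ} {σ : ℕ → Ω → Option A}

/-- Against a strategic agent, the rewards are within `ε / L₁` of the values of the myopic best
responses to the thresholds announced. -/
theorem IsStrategic.ae_abs_rewardAt_sub_le (hγ : γ ∈ Ioo (0 : ℝ) 1) (hε : 0 < ε)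
    (hεy : ε ≤ ymin) (hL₁ : 0 < L₁) (hy : I.AgentUtilityGT ymin) (hLip : I.StochasticLipschitz L₁)
    (hD : γ ^ (D + 1) / (1 - γ) < ε) (hσ : R.IsStrategic (mechanism T Q D δ) γ T σ) :
    ∀ᵐ ω ∂P, ∀ t < T, |R.rewardAt (mechanism T Q D δ) σ t ω -
      (R.w t ω).bestResponseValue (Ici ((R.pulledArm T Q D δ σ t ω : ℝ) / Q))| ≤ ε / L₁ := by
  have hopt : ∀ᵐ ω ∂P, ∀ t < T, _ := ae_all_iff.2 fun t =>
    Filter.eventually_imp_distrib_left.2 fun ht => hσ.ae_near_optimal hγ hD ht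
  filter_upwards [hopt, R.ae_of_ae_law hy, R.ae_of_ae_law hLip] with ω h1 h2 h3 t ht
  have h := Realization.abs_principalPayoff_sub_bestResponseValue_le _ hε hεy hL₁ (h2 t) (h3 t)
    (h1 t ht)
  rw [rewardAt, reward_eq]
  rw [announced_eq] at h ⊢
  exact h

end DelegationProcess

theorem mainTheorem1
    -- The objective `f` on `[0, 1]` has a unique maximizer `τs` in `(0, 1)`, with `f''(τs) < 0`.
    (f : ℝ → ℝ) (τs : ℝ) (hτs : τs ∈ Set.Ioo (0 : ℝ) 1)
    (hmax : ∀ τ ∈ Set.Icc (0 : ℝ) 1, τ ≠ τs → f τ < f τs)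
    (husc : UpperSemicontinuousOn f (Set.Icc 0 1))
    (hdiff : ∀ᶠ τ in nhds τs, DifferentiableAt ℝ f τ)
    (hdiff2 : DifferentiableAt ℝ (deriv f) τs)
    (hneg : deriv (deriv f) τs < 0) :
    -- The constant depends on `f` only.
    ∃ C : ℝ, 0 < C ∧
      ∀ (T : ℕ) (γ L₁ ymin : ℝ), 2 ≤ T → γ ∈ Set.Ioo (0 : ℝ) 1 → 0 < L₁ → 0 < ymin →
      ∀ (A : Type*) [Fintype A] (I : DelegationInstance A),
        (∀ τ ∈ Set.Icc (0 : ℝ) 1, I.thresholdValue τ = f τ) →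
        I.AgentUtilityGT ymin → I.StochasticLipschitz L₁ →
      ∀ (Ω : Type*) [MeasurableSpace Ω] (P : MeasureTheory.Measure Ω)
        [MeasureTheory.IsProbabilityMeasure P] (R : DelegationProcess I P)
        (σ : ℕ → Ω → Option A),
        R.IsStrategic (delayedSuccessiveElimination T γ L₁ ymin) γ T σ →
        R.regret (delayedSuccessiveElimination T γ L₁ ymin) T σ ≤
          C * (√(T * Real.log T) +
            effectiveHorizon γ * Real.log (effectiveHorizon γ * max (T / L₁) (1 / ymin)) *
              Real.log T) := by
  obtain ⟨c, C, hc, hC, hlow, hupp⟩ := exists_quadratic_bounds hτs hmax husc hdiff hdiff2 hneg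
  obtain ⟨K, hK0, hK⟩ := exists_sum_one_div_one_add_sq_le
  have hM0 : 0 < min c C := lt_min hc hC
  -- The factor of `√(T log T)` that the bounds below add up to; the delay term only needs `3`.
  refine ⟨2 * C + 3072 / min c C * K + 29, by positivity, ?_⟩
  intro T γ L₁ ymin hT hγ hL₁ hymin A _ I hf hy hLip Ω _ P _ R σ hσ
  have hT2 : (2 : ℝ) ≤ T := by exact_mod_cast hT
  -- Without solutions the objective would vanish identically; nonemptiness gives `ε < 1`, hence
  -- `0 ≤ G` below.
  have hA : Nonempty A := by
    by_contra hA
    have := not_nonempty_iff.1 hA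
    have h0 : (0 : ℝ) ∈ Icc (0 : ℝ) 1 := ⟨le_rfl, zero_le_one⟩
    have h1 := hmax 0 h0 hτs.1.ne
    rw [← hf 0 h0, ← hf τs (Ioo_subset_Icc_self hτs), I.thresholdValue_eq_zero,
      I.thresholdValue_eq_zero] at h1
    exact lt_irrefl _ h1
  have hf01 : ∀ x ∈ Icc (0 : ℝ) 1, f x ∈ Icc (0 : ℝ) 1 := fun x hx =>
    hf x hx ▸ I.thresholdValue_mem_Icc x
  have hopt : I.opt T = T * f τs := by
    have : IsGreatest (I.thresholdValue '' Icc 0 1) (f τs) := by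
      refine ⟨⟨τs, Ioo_subset_Icc_self hτs, hf _ (Ioo_subset_Icc_self hτs)⟩, ?_⟩
      rintro _ ⟨x, hx, rfl⟩
      rw [hf x hx]
      rcases eq_or_ne x τs with rfl | hne
      · exact le_rfl
      · exact (hmax x hx hne).le
    rw [DelegationInstance.opt, this.csSup_eq]
  set ε := min (L₁ / T) ymin with hε
  have hε0 : 0 < ε := lt_min (by positivity) hymin
  have hε1 : ε < 1 := (min_le_right _ _).trans_lt hy.lt_one
  set H := effectiveHorizon γ with hH
  have hH1 : 1 ≤ H := by
    rw [hH, effectiveHorizon, le_div_iff₀ (by linarith [hγ.2])]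
    linarith [hγ.1]
  have hinv : max (T / L₁) (1 / ymin) = 1 / ε := by
    refine le_antisymm (max_le ?_ ?_) ?_
    · rw [← one_div_div]
      exact one_div_le_one_div_of_le hε0 (min_le_left _ _)
    · exact one_div_le_one_div_of_le hε0 (min_le_right _ _)
    · rcases min_choice (L₁ / T) ymin with h | h
      · rw [hε, h, one_div_div]; exact le_max_left _ _
      · rw [hε, h]; exact le_max_right _ _
  rw [hinv, mul_one_div]
  set G := H * Real.log (H / ε) with hG
  have hG0 : 0 ≤ G := by
    refine mul_nonneg (by linarith) (Real.log_nonneg ?_)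
    rw [le_div_iff₀ hε0]
    linarith
  set Q := ⌈((T : ℝ) / Real.log T) ^ (1 / 4 : ℝ)⌉₊ with hQdef
  set D := ⌈G⌉₊ with hDdef
  set δ := ε / L₁ with hδ
  change R.IsStrategic (SuccessiveElimination.mechanism T Q D δ) γ T σ at hσ
  change R.regret (SuccessiveElimination.mechanism T Q D δ) T σ ≤ _
  obtain ⟨hQ1, hQT, hS1, hL2, hLS, hQS, hTQ, hLQ⟩ := grid_size_bounds hT hQdef
  have hδ0 : 0 ≤ δ := by positivity
  have hδT : T * δ ≤ 1 := by
    have h1 : ε ≤ L₁ / T := min_le_left _ _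
    rw [le_div_iff₀ (by linarith)] at h1
    rw [hδ, mul_div_assoc', div_le_one hL₁]
    linarith
  have hD1 : (D : ℝ) ≤ G + 1 := (Nat.ceil_lt_add_one hG0).le
  have hclose := hσ.ae_abs_rewardAt_sub_le hγ hε0 (min_le_right _ _) hL₁ hy hLip
    (pow_delay_div_lt hγ hε0 (Nat.le_ceil G))
  have hlogQ : 0 ≤ Real.log Q := Real.log_natCast_nonneg Q
  have hgrid : ∀ i ∈ Finset.Icc 1 Q, I.thresholdValue ((i : ℝ) / Q) = f (i / Q) := by
    intro i hi
    have hQ0 : (0 : ℝ) < Q := by exact_mod_cast hQ1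
    have : (i : ℝ) ≤ Q := by exact_mod_cast (Finset.mem_Icc.1 hi).2
    exact hf _ ⟨by positivity, (div_le_one hQ0).2 this⟩
  set S := √(T * Real.log T) with hS
  have hregret := DelegationProcess.regret_le_of_confidenceValid hσ.1 hT hQ1 hQT hδ0 hδT hclose
    hopt (hf01 τs (Ioo_subset_Icc_self hτs)).2
    (B := 2 * C * (T / (Q : ℝ) ^ 2) + 8 + 768 / min c C * K * (Real.log T * (Q : ℝ) ^ 2) +
        D * (1 + Real.log Q) + 4 * Q) (by positivity) (fun r hr => by
      have hr' : SuccessiveElimination.ConfidenceValid T Q D δ r fun i => f (i / Q) :=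
        fun i hi m hm => by
          have h := hr i hi m hm
          beta_reduce at h ⊢
          rw [← hgrid i hi]
          exact h
      have := hr'.sum_regret_le hδ0 hδT hQ1 hT hτs hf01 hc hC hlow (hupp hf01) hK
      refine le_trans (le_of_eq (Finset.sum_congr rfl fun t _ => ?_)) this
      rw [hgrid _ (SuccessiveElimination.armAt_mem_Icc hδ0 hQ1 t)])
  have hDQ : D * (1 + Real.log Q) ≤ 3 * S + 3 * (G * Real.log T) := by
    have h1 : Real.log Q ≤ Real.log T :=
      Real.log_le_log (by exact_mod_cast hQ1) (by exact_mod_cast hQT)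
    calc D * (1 + Real.log Q) ≤ (G + 1) * (3 * Real.log T) := by gcongr; linarith
      _ ≤ _ := by nlinarith
  have hCT : 2 * C * (T / (Q : ℝ) ^ 2) ≤ 2 * C * S := by gcongr
  have hKL : 768 / min c C * K * (Real.log T * (Q : ℝ) ^ 2) ≤
      768 / min c C * K * (4 * S) := by gcongr
  have hE : 768 / min c C * K * (4 * S) = 3072 / min c C * K * S := by ring
  have hGL : 0 ≤ G * Real.log T := by positivity
  have hextra : 0 ≤ (2 * C + 3072 / min c C * K) * (G * Real.log T) := by positivity
  calc _ ≤ _ := hregret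
    _ ≤ _ := by
      rw [mul_add]
      linarith
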